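/- **Theorem (No black-box reduction of prior entanglement).** Consider one-round (Alice to Bob) quantum protocols with prior entanglement for functions on $\{0,1\}^n\times\{0,1\}^n$. Such a protocol starts with an input-independent pure state $|\phi\rangle$ on $m+m$ qubits ($m$ held by Alice, $m$ held by Bob), all work qubits being $|0\rangle$. On input $x$, Alice applies a unitary $U_x$ to her qubits (her share of $|\phi\rangle$, her work qubits, and a $c$-qubit message register), measures the message register in the computational basis, and sends the resulting $c$ bits to Bob. On input $y$, Bob applies a unitary $V_y$ to the message, his share of $|\phi\rangle$ and his work qubits, and then performs a von Neumann measurement whose outcome is the output. Write $\mathcal P(x,y)$ for the output distribution. The protocol computes $f$ if for all $x,y$ it outputs $f(x,y)$ with probability at least $2/3$. Two protocols $\mathcal P,\mathcal P'$ are *similar* if they use the same numbers of qubits, the same unitary transformations and measurements, and the same amount of communication (so that only their prior entangled states may differ), and the total variation distance $\frac12\|\mathcal P(x,y)-\mathcal P'(x,y)\|_1$ is less than $1/20$ for all $x,y\in\{0,1\}^n$. For a bipartite pure state with Schmidt decomposition $|\phi\rangle=\sum_i\sqrt{\lambda_i}\,|a_i\rangle\otimes|b_i\rangle$, the *amount of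 entanglement* is $E(|\phi\rangle)=-\sum_i\lambda_i\log_2\lambda_i$. Let $\mathrm{EQ}_n$ be the Equality function on $n$-bit strings. There are constants $c_1,c_2>0$ such that for every $n\ge 1$ there are an integer $m$ with $$\tfrac{2n}{3}+\log_2 n+c_1\le m\le\tfrac{2n}{3}+\log_2 n+c_2$$ and a one-round protocol $\mathcal P$ for $\mathrm{EQ}_n$ whose prior entanglement is $m$ EPR pairs and whose communication is $4$ bits, such that no protocol $\mathcal P'$ similar to $\mathcal P$ starts with a prior entangled state $|\phi\rangle$ with $E(|\phi\rangle)\le n/600$. -/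

import Mathlib

noncomputable section

namespace EntanglementReduction

open Matrix

/-- Bit strings of length `k`; they label the computational basis of `k` qubits. -/
abbrev Bits (k : ℕ) : Type := Fin k → Bool

/-! ### Bipartite pure states and their amount of entanglement -/

section Schmidt

open scoped ComplexOrder

variable {ι κ : Type} [Fintype ι] [Fintype κ]

/-- A Schmidt decomposition `φ = ∑ₗ √(λ l) • a l ⊗ b l` of a bipartite vector `φ ∈ ℂ^ι ⊗ ℂ^κ`. -/
structure SchmidtDecomposition (φ : EuclideanSpace ℂ (ι × κ)) where
  rank : ℕ
  coeff : Fin rank → ℝ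
  left : Fin rank → EuclideanSpace ℂ ι
  right : Fin rank → EuclideanSpace ℂ κ
  coeff_nonneg : ∀ l, 0 ≤ coeff l
  left_orthonormal : Orthonormal ℂ left
  right_orthonormal : Orthonormal ℂ right
  eq_sum : ∀ i j, φ (i, j) = ∑ l, ((√(coeff l) : ℝ) : ℂ) * (left l i * right l j)

/-- The entropy `-∑ₗ λ l * log₂ (λ l)` of the Schmidt coefficients, in bits. -/
def SchmidtDecomposition.entropy {φ : EuclideanSpace ℂ (ι × κ)}
    (D : SchmidtDecomposition φ) : ℝ :=
  -∑ l, D.coeff l * Real.logb 2 (D.coeff l)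

/-- The matrix of coefficients of a bipartite vector. -/
def coeffMatrix (φ : EuclideanSpace ℂ (ι × κ)) : Matrix ι κ ℂ :=
  Matrix.of fun i j => φ (i, j)

/-- Every bipartite vector has a Schmidt decomposition. -/
theorem nonempty_schmidtDecomposition (φ : EuclideanSpace ℂ (ι × κ)) :
    Nonempty (SchmidtDecomposition φ) := by
  classical
  set A := coeffMatrix φ with hA
  have hG : (A * Aᴴ).PosSemidef := Matrix.posSemidef_self_mul_conjTranspose A
  set u := hG.1.eigenvectorBasis with hu
  set ev := hG.1.eigenvalues with hev
  have ev0 : ∀ i, 0 ≤ ev i := hG.eigenvalues_nonneg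
  let r : ι → κ → ℂ := fun i j => ∑ p, star (u i p) * A p j
  have hr : ∀ i k, ∑ j, star (r i j) * r k j = if i = k then (ev i : ℂ) else 0 := by
    intro i k
    have h1 : (A * Aᴴ) *ᵥ (u i).ofLp = ev i • (u i).ofLp := hG.1.mulVec_eigenvectorBasis i
    have h2 : ∑ p, star (u k p) * u i p = if k = i then (1 : ℂ) else 0 := by
      have := (orthonormal_iff_ite.1 u.orthonormal) k i
      rw [← this, PiLp.inner_apply]
      refine Finset.sum_congr rfl fun p _ => ?_
      simp [mul_comm]
    have h3 : ∑ j, star (r i j) * r k j = ∑ p, star (u k p) * ((A * Aᴴ) *ᵥ (u i).ofLp) p := by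
      simp only [r, star_sum, star_mul', star_star, Matrix.mulVec, dotProduct, Matrix.mul_apply,
        Matrix.conjTranspose_apply, Finset.sum_mul, Finset.mul_sum]
      rw [Finset.sum_comm]
      rw [Finset.sum_congr rfl fun p _ => Finset.sum_comm]
      refine Finset.sum_congr rfl fun p _ => Finset.sum_congr rfl fun q _ =>
        Finset.sum_congr rfl fun j _ => ?_
      ring
    rw [h3, h1]
    have : ∀ p, star (u k p) * (ev i • (u i).ofLp) p = (ev i : ℂ) * (star (u k p) * u i p) := by
      intro p; simp; ring
    rw [Finset.sum_congr rfl fun p _ => this p, ← Finset.mul_sum, h2]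
    by_cases h : i = k
    · subst h; simp
    · simp [h, Ne.symm h]
  have hA2 : ∀ p j, A p j = ∑ i, u i p * r i j := by
    intro p j
    have h : ∀ p q, ∑ i, u i p * star (u i q) = if p = q then (1 : ℂ) else 0 := by
      intro p q
      have := congrFun (congrFun
        (Unitary.coe_mul_star_self hG.1.eigenvectorUnitary) p) q
      simp only [Matrix.mul_apply,
        Matrix.IsHermitian.eigenvectorUnitary_apply, Matrix.one_apply] at this
      exact this
    simp only [r, Finset.mul_sum]
    rw [Finset.sum_comm]
    simp only [← mul_assoc, ← Finset.sum_mul, h]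
    simp
  have hr0 : ∀ i, ev i = 0 → ∀ j, r i j = 0 := by
    intro i hi
    have h := hr i i
    rw [if_pos rfl, hi] at h
    have h' : star (r i) ⬝ᵥ r i = 0 := by simpa [dotProduct] using h
    have := dotProduct_star_self_eq_zero.1 h'
    exact fun j => congrFun this j
  let S := {i : ι // ev i ≠ 0}
  let e : Fin (Fintype.card S) ≃ S := (Fintype.equivFin S).symm
  have spos : ∀ s : S, (((√(ev s.1) : ℝ) : ℂ)) ≠ 0 := by
    intro s
    have : 0 < ev s.1 := lt_of_le_of_ne (ev0 _) (Ne.symm s.2)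
    exact_mod_cast (Real.sqrt_pos.2 this).ne'
  have ssq : ∀ i, (((√(ev i) : ℝ) : ℂ)) * ((√(ev i) : ℝ) : ℂ) = ev i := by
    intro i
    exact_mod_cast Real.mul_self_sqrt (ev0 i)
  let b : S → EuclideanSpace ℂ κ := fun s =>
    WithLp.toLp 2 fun j => (((√(ev s.1) : ℝ) : ℂ))⁻¹ * r s.1 j
  have hb : Orthonormal ℂ b := by
    rw [orthonormal_iff_ite]
    intro s t
    have h1 : inner ℂ (b s) (b t) =
        (((√(ev s.1) : ℝ) : ℂ))⁻¹ * (((√(ev t.1) : ℝ) : ℂ))⁻¹ *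
          ∑ j, star (r s.1 j) * r t.1 j := by
      rw [PiLp.inner_apply, Finset.mul_sum]
      refine Finset.sum_congr rfl fun j _ => ?_
      simp [b]
      ring
    rw [h1, hr]
    by_cases h : s = t
    · subst h
      have := spos s
      rw [if_pos rfl, if_pos rfl, ← ssq]
      field_simp
    · have : s.1 ≠ t.1 := fun h' => h (Subtype.ext h')
      simp [h, this]
  refine ⟨⟨Fintype.card S, fun l => ev (e l).1, fun l => u (e l).1, fun l => b (e l),
    fun l => ev0 _, ?_, ?_, ?_⟩⟩
  · exact u.orthonormal.comp _ (Subtype.val_injective.comp e.injective)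
  · exact hb.comp _ e.injective
  · intro p j
    have h1 : φ (p, j) = A p j := rfl
    rw [h1, hA2, e.sum_comp (fun s : S => (((√(ev s.1) : ℝ) : ℂ)) * (u s.1 p * b s j))]
    have h2 : ∀ s : S, (((√(ev s.1) : ℝ) : ℂ)) * (u s.1 p * b s j) = u s.1 p * r s.1 j := by
      intro s
      have := spos s
      simp only [b]
      field_simp
    rw [Finset.sum_congr rfl fun s _ => h2 s]
    rw [← Finset.sum_filter_of_ne (p := fun i => ev i ≠ 0) fun i _ h hi => h (by simp [hr0 i hi])]
    exact (Finset.sum_subtype _ (by simp) _)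

theorem SchmidtDecomposition.entropy_eq_roots [DecidableEq ι] {φ : EuclideanSpace ℂ (ι × κ)}
    (D : SchmidtDecomposition φ) :
    D.entropy = -((coeffMatrix φ * (coeffMatrix φ)ᴴ).charpoly.roots.map
      fun z => z.re * Real.logb 2 z.re).sum := by
  have hcard : Fintype.card (Fin D.rank) ≤ Fintype.card ι := by
    have := D.left_orthonormal.linearIndependent.fintype_card_le_finrank
    simpa using this
  obtain ⟨e⟩ := Function.Embedding.nonempty_of_card_le hcard
  have hv : Orthonormal ℂ ((Set.range e).domRestrict (Function.extend e D.left 0)) := by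
    let f : Set.range e → Fin D.rank := fun s => s.2.choose
    have hf : ∀ s, e (f s) = s.1 := fun s => s.2.choose_spec
    have : (Set.range e).domRestrict (Function.extend e D.left 0) = D.left ∘ f := by
      funext s
      rw [Set.domRestrict_apply, ← hf s, e.injective.extend_apply]
      rfl
    rw [this]
    refine D.left_orthonormal.comp f fun s t h => Subtype.ext ?_
    rw [← hf s, ← hf t, h]
  obtain ⟨b, hb⟩ := hv.exists_orthonormalBasis_extension_of_card_eq (by simp)
  set μ : ι → ℝ := Function.extend e D.coeff 0 with hμ
  let U : Matrix ι ι ℂ := Matrix.of fun p i => b i p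
  have hUU : Uᴴ * U = 1 := by
    ext i k
    have := (orthonormal_iff_ite.1 b.orthonormal) i k
    rw [Matrix.mul_apply, Matrix.one_apply, ← this, PiLp.inner_apply]
    refine Finset.sum_congr rfl fun p _ => ?_
    simp [U, mul_comm]
  have hG : coeffMatrix φ * (coeffMatrix φ)ᴴ =
      U * (Matrix.diagonal fun i => (μ i : ℂ)) * Uᴴ := by
    ext p q
    have hR := orthonormal_iff_ite.1 D.right_orthonormal
    have hsum : ∀ F : ι → ℂ, (∀ i, i ∉ Set.range e → F i = 0) → ∑ i, F i = ∑ l, F (e l) := by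
      intro F hF
      symm
      rw [← Finset.sum_map Finset.univ e F]
      refine Finset.sum_subset (Finset.subset_univ _) fun i _ hi => hF i ?_
      simpa using hi
    rw [Matrix.mul_assoc, Matrix.mul_apply, Matrix.mul_apply, hsum]
    · have hbe : ∀ l, b (e l) = D.left l := fun l => by
        rw [hb _ ⟨l, rfl⟩, e.injective.extend_apply]
      have hμe : ∀ l, μ (e l) = D.coeff l := fun l => e.injective.extend_apply _ _ _
      have h1 : ∀ l, U p (e l) * ((Matrix.diagonal fun i => (μ i : ℂ)) * Uᴴ) (e l) q
          = D.left l p * (D.coeff l : ℂ) * star (D.left l q) := by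
        intro l
        simp [U, Matrix.diagonal_mul, hbe, hμe, mul_assoc]
      rw [Finset.sum_congr rfl fun l _ => h1 l]
      simp only [coeffMatrix, Matrix.conjTranspose_apply, Matrix.of_apply, D.eq_sum, star_sum]
      simp only [Finset.sum_mul, Finset.mul_sum]
      rw [Finset.sum_comm]
      refine Finset.sum_congr rfl fun l _ => ?_
      rw [Finset.sum_comm]
      have h2 : ∀ l', ∑ j, ((√(D.coeff l') : ℝ) : ℂ) * (D.left l' p * D.right l' j) *
          star (((√(D.coeff l) : ℝ) : ℂ) * (D.left l q * D.right l j)) =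
          ((√(D.coeff l') : ℝ) : ℂ) * ((√(D.coeff l) : ℝ) : ℂ) * D.left l' p *
            star (D.left l q) * (if l = l' then 1 else 0) := by
        intro l'
        rw [← hR l l', PiLp.inner_apply, Finset.mul_sum]
        refine Finset.sum_congr rfl fun j _ => ?_
        simp
        ring
      rw [Finset.sum_congr rfl fun l' _ => h2 l']
      simp only [mul_ite, mul_one, mul_zero, Finset.sum_ite_eq, Finset.mem_univ, if_true]
      have : ((√(D.coeff l) : ℝ) : ℂ) * ((√(D.coeff l) : ℝ) : ℂ) = D.coeff l := by
        exact_mod_cast Real.mul_self_sqrt (D.coeff_nonneg l)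
      rw [this]
      ring
    · intro i hi
      have : μ i = 0 := by
        rw [hμ, Function.extend_apply' _ _ _ (by simpa using hi)]; rfl
      simp [Matrix.diagonal_mul, this]
  have hchar : (coeffMatrix φ * (coeffMatrix φ)ᴴ).charpoly =
      ∏ i, (Polynomial.X - Polynomial.C (μ i : ℂ)) := by
    rw [hG, Matrix.charpoly_mul_comm, ← Matrix.mul_assoc, hUU, Matrix.one_mul,
      Matrix.charpoly_diagonal]
  have hroots : (∏ i, (Polynomial.X - Polynomial.C (μ i : ℂ))).roots =
      Finset.univ.val.map fun i => (μ i : ℂ) := by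
    rw [← Polynomial.roots_multiset_prod_X_sub_C (Finset.univ.val.map fun i => (μ i : ℂ)),
      Multiset.map_map]
    rfl
  rw [hchar, hroots, Multiset.map_map]
  unfold SchmidtDecomposition.entropy
  congr 1
  change _ = ∑ i, ((μ i : ℂ)).re * Real.logb 2 ((μ i : ℂ)).re
  simp only [Complex.ofReal_re]
  have h1 : ∀ l, D.coeff l * Real.logb 2 (D.coeff l) = μ (e l) * Real.logb 2 (μ (e l)) := by
    intro l
    rw [show μ (e l) = D.coeff l from e.injective.extend_apply _ _ _]
  rw [Finset.sum_congr rfl fun l _ => h1 l,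
    ← Finset.sum_map Finset.univ e fun i => μ i * Real.logb 2 (μ i)]
  refine Finset.sum_subset (Finset.subset_univ _) fun i _ hi => ?_
  have hi' : ¬ ∃ l, e l = i := by simpa using hi
  have : μ i = 0 := by
    rw [hμ, Function.extend_apply' _ _ _ hi']; rfl
  simp [this]

/-- All Schmidt decompositions of a bipartite vector have the same entropy. -/
theorem SchmidtDecomposition.entropy_eq {φ : EuclideanSpace ℂ (ι × κ)}
    (D D' : SchmidtDecomposition φ) : D.entropy = D'.entropy := by
  classical
  rw [D.entropy_eq_roots, D'.entropy_eq_roots]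

/-- The amount of entanglement `E(φ) = -∑ₗ λ l * log₂ (λ l)`, where `λ` are the Schmidt
coefficients of `φ`. -/
def entanglement (φ : EuclideanSpace ℂ (ι × κ)) : ℝ :=
  (Classical.choice (nonempty_schmidtDecomposition φ)).entropy

/-- The amount of entanglement may be computed from any Schmidt decomposition. -/
theorem entanglement_eq {φ : EuclideanSpace ℂ (ι × κ)} (D : SchmidtDecomposition φ) :
    entanglement φ = D.entropy :=
  SchmidtDecomposition.entropy_eq _ D

end Schmidt

/-- The amplitudes of a single EPR pair `(|00⟩ + |11⟩) / √2`. -/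
def eprPair (s t : Bool) : ℂ :=
  if s = t then 1 / ((√2 : ℝ) : ℂ) else 0

/-- `m` EPR pairs, the first halves being with Alice and the second halves with Bob. -/
def eprPairs (m : ℕ) : EuclideanSpace ℂ (Bits m × Bits m) :=
  WithLp.toLp 2 fun q => ∏ i, eprPair (q.1 i) (q.2 i)

/-! ### One-round protocols with prior entanglement -/

/-- A von Neumann measurement on the space `ℂ^q` with outcomes in `Z`: a family of orthogonal
projections that sum to the identity. -/
structure VonNeumannMeasurement (q : Type) [Fintype q] [DecidableEq q]
    (Z : Type) [Fintype Z] where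
  proj : Z → Matrix q q ℂ
  isHermitian : ∀ z, (proj z).IsHermitian
  idempotent : ∀ z, proj z * proj z = proj z
  sum_eq_one : ∑ z, proj z = 1

/-- Alice's registers: her share of the prior entanglement (`m` qubits), her work qubits (`a`),
and the message register (`c` qubits). -/
abbrev AliceReg (m a c : ℕ) : Type := Bits m × Bits a × Bits c

/-- Bob's registers: the received message (`c` bits), his share of the prior entanglement
(`m` qubits), and his work qubits (`b`). -/
abbrev BobReg (m b c : ℕ) : Type := Bits c × Bits m × Bits b

/-- The operations of a one-round protocol (one message, from Alice to Bob) on `n`-bit inputs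
with outputs in `Z`. The players share a state on `m + m` qubits, use `a` and `b` work qubits,
and communicate `c` bits.
* On input `x`, Alice applies the unitary `alice x`, measures the message register in the
  computational basis, and sends the resulting `c` bits.
* On input `y`, Bob applies the unitary `bob y` and then performs the measurement `meas`, whose
  outcome is the output. -/
structure OneRoundOperations (n m a b c : ℕ) (Z : Type) [Fintype Z] where
  alice : Bits n → Matrix.unitaryGroup (AliceReg m a c) ℂ
  bob : Bits n → Matrix.unitaryGroup (BobReg m b c) ℂ
  meas : VonNeumannMeasurement (BobReg m b c) Z

/-- A one-round protocol with prior entanglement: its operations, and the input-independent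
pure state that the players share at the start. -/
structure OneRoundProtocol (n m a b c : ℕ) (Z : Type) [Fintype Z] where
  ops : OneRoundOperations n m a b c Z
  prior : EuclideanSpace ℂ (Bits m × Bits m)
  norm_prior : ‖prior‖ = 1

namespace OneRoundProtocol

variable {n m a b c : ℕ} {Z : Type} [Fintype Z]

/-- The all-zero bit string. -/
abbrev zeros (k : ℕ) : Bits k := fun _ => false

/-- The initial joint state: the prior entanglement, with all work qubits and the message
register in the state `|0⟩`. -/
def initial (P : OneRoundProtocol n m a b c Z) (p : AliceReg m a c) (q : Bits m × Bits b) : ℂ :=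
  if p.2.1 = zeros a ∧ p.2.2 = zeros c ∧ q.2 = zeros b then P.prior (p.1, q.1) else 0

/-- The joint state after Alice's unitary transformation on input `x`. -/
def afterAlice (P : OneRoundProtocol n m a b c Z) (x : Bits n)
    (p : AliceReg m a c) (q : Bits m × Bits b) : ℂ :=
  ∑ p', (P.ops.alice x : Matrix (AliceReg m a c) (AliceReg m a c) ℂ) p p' * P.initial p' q

/-- The unnormalized joint state in the branch in which the message is `j`: here `r` labels the
registers that Alice keeps, and the result is a vector on Bob's registers. The square of the norm
of this state is the probability of the message `j`. -/
def afterMessage (P : OneRoundProtocol n m a b c Z) (x : Bits n) (j : Bits c)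
    (r : Bits m × Bits a) : BobReg m b c → ℂ :=
  fun q => if q.1 = j then P.afterAlice x (r.1, r.2, j) q.2 else 0

/-- The probability `P(x, y)(z)` that the protocol outputs `z` on input `(x, y)`. -/
def outputProb (P : OneRoundProtocol n m a b c Z) (x y : Bits n) (z : Z) : ℝ :=
  ∑ j, ∑ r, ∑ q, ‖(P.ops.meas.proj z *ᵥ
    ((P.ops.bob y : Matrix (BobReg m b c) (BobReg m b c) ℂ) *ᵥ P.afterMessage x j r)) q‖ ^ 2

/-- The protocol computes `f` with error at most `ε` on every input. -/
def Computes (P : OneRoundProtocol n m a b c Z) (ε : ℝ) (f : Bits n → Bits n → Z) : Prop :=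
  ∀ x y, 1 - ε ≤ P.outputProb x y (f x y)

end OneRoundProtocol

/-- The total variation distance of two distributions on a finite set. -/
def totalVariation {Z : Type} [Fintype Z] (p q : Z → ℝ) : ℝ :=
  (∑ z, |p z - q z|) / 2

/-- Two protocols on the same numbers of qubits and with the same amount of communication are
similar if they use the same unitary transformations and measurements, and on every input their
output distributions differ by less than `1 / 20` in total variation. Their prior entangled
states may differ. -/
def Similar {n m a b c : ℕ} {Z : Type} [Fintype Z] (P P' : OneRoundProtocol n m a b c Z) : Prop :=
  P.ops = P'.ops ∧
    ∀ x y, totalVariation (P.outputProb x y) (P'.outputProb x y) < 1 / 20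

/-- The Equality function on `n`-bit strings. -/
def equality (n : ℕ) (x y : Bits n) : Bool :=
  decide (x = y)

end EntanglementReduction

end

/-! Identify a bipartite vector with its coefficient matrix `M`; then `P ⊗ Qᵀ` acts as `M ↦ P * M *
Q`. The protocol encodes an input by a string of Pauli labels on `m` qubits, split into four blocks
by residue modulo 4. Alice measures the four commuting Pauli strings, one per block, and sends the
four signs; Bob measures the transposes for his own input and accepts if all signs agree.

On EPR pairs `M` is a multiple of the identity, so equal inputs are always accepted. For different
inputs the acceptance probability is the fraction of the 16 sets of blocks on which the two masked
label strings coincide (`sum_trace_spectralProj_mul` and orthogonality of Pauli strings). A parity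
check makes distinct codewords differ in at least two blocks, so this fraction is at most 1/4.

A similar protocol must accept every pair `(x, x)` with probability above 19/20. Hence every
first-block string `P` has correlation `⟨P ⊗ Pᵀ⟩ > 9/10` in its prior state
(`IsReflectionGroup.sum_frobeniusSq_le`, `lt_re_pauliCorrelation`). For `n ≥ 2` the code is such
that these strings include all `4 ^ k` Pauli strings on `k = ⌊(n + 4) / 6⌋` qubits. But a Bessel
inequality for Pauli strings shows that the average of `|⟨P ⊗ Pᵀ⟩|` over them is at most `r / 2 ^ k`
for a vector of Schmidt rank `r` and norm at most 1
(`SchmidtDecomposition.sum_norm_pauliCorrelation_le`). A state of entanglement at most `n / 600` is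
close to such a vector with `r < 2 ^ ⌈n / 15⌉` (`SchmidtDecomposition.exists_truncation`), and
truncation lowers the correlations only to 11/20, while the average is at most 1/2: a contradiction.
For `n = 1`, where `k = 0`, the two inputs are encoded by `Z` and `X` on one qubit, and the same
inequality suffices. -/

namespace EntanglementReduction

open Matrix

/-! ### The Hilbert–Schmidt norm -/

section Frobenius

variable {α β γ : Type} [Fintype α] [Fintype β] [Fintype γ]

/-- The square of the Hilbert–Schmidt norm. -/
noncomputable def frobeniusSq (M : Matrix α β ℂ) : ℝ := ∑ p, ∑ q, ‖M p q‖ ^ 2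

theorem frobeniusSq_nonneg (M : Matrix α β ℂ) : 0 ≤ frobeniusSq M :=
  Finset.sum_nonneg fun _ _ => Finset.sum_nonneg fun _ _ => by positivity

theorem coe_frobeniusSq (M : Matrix α β ℂ) : (frobeniusSq M : ℂ) = (Mᴴ * M).trace := by
  simp only [frobeniusSq, Matrix.trace, Matrix.diag_apply, Matrix.mul_apply,
    Matrix.conjTranspose_apply, Complex.ofReal_sum]
  rw [Finset.sum_comm]
  refine Finset.sum_congr rfl fun p _ => Finset.sum_congr rfl fun q _ => ?_
  rw [Complex.star_def, Complex.conj_mul', Complex.ofReal_pow]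

theorem frobeniusSq_eq_re (M : Matrix α β ℂ) : frobeniusSq M = ((Mᴴ * M).trace).re := by
  rw [← coe_frobeniusSq, Complex.ofReal_re]

theorem norm_trace_mul_le (M N : Matrix α β ℂ) :
    ‖(Mᴴ * N).trace‖ ≤ √(frobeniusSq M) * √(frobeniusSq N) := by
  let v : Matrix α β ℂ → EuclideanSpace ℂ (α × β) := fun A => WithLp.toLp 2 fun p => A p.1 p.2
  have hn : ∀ A, ‖v A‖ = √(frobeniusSq A) := fun A => by
    rw [EuclideanSpace.norm_eq, Fintype.sum_prod_type]; rfl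
  have hi : (Mᴴ * N).trace = inner ℂ (v M) (v N) := by
    rw [PiLp.inner_apply, Fintype.sum_prod_type]
    simp only [Matrix.trace, Matrix.diag_apply, Matrix.mul_apply, Matrix.conjTranspose_apply]
    rw [Finset.sum_comm]
    refine Finset.sum_congr rfl fun p _ => Finset.sum_congr rfl fun q _ => ?_
    simp [v, mul_comm]
  rw [hi, ← hn, ← hn]
  exact norm_inner_le_norm _ _

theorem frobeniusSq_conjTranspose (M : Matrix α β ℂ) : frobeniusSq Mᴴ = frobeniusSq M := by
  unfold frobeniusSq
  rw [Finset.sum_comm]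
  simp

theorem frobeniusSq_unitary_mul [DecidableEq α] {P : Matrix α α ℂ} (hP : Pᴴ * P = 1)
    (M : Matrix α β ℂ) : frobeniusSq (P * M) = frobeniusSq M := by
  rw [frobeniusSq_eq_re, frobeniusSq_eq_re, conjTranspose_mul, Matrix.mul_assoc,
    ← Matrix.mul_assoc _ P M, hP, Matrix.one_mul]

theorem frobeniusSq_mul_unitary [DecidableEq β] {P : Matrix β β ℂ} (hP : P * Pᴴ = 1)
    (M : Matrix α β ℂ) : frobeniusSq (M * P) = frobeniusSq M := by
  rw [← frobeniusSq_conjTranspose, conjTranspose_mul, frobeniusSq_unitary_mul (by simpa using hP),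
    frobeniusSq_conjTranspose]

end Frobenius

/-! ### Families of orthogonal projections -/

section Projections

variable {Z R κ : Type} [Fintype Z] [Fintype R] [DecidableEq R] [Fintype κ]

/-- A projective measurement: a family of mutually orthogonal projections summing to `1`. -/
structure IsProjectiveMeasurement (F : Z → Matrix R R ℂ) : Prop where
  isHermitian : ∀ z, (F z).IsHermitian
  mul_self : ∀ z, F z * F z = F z
  mul_of_ne : ∀ z z', z ≠ z' → F z * F z' = 0
  sum_eq_one : ∑ z, F z = 1

/-- Pythagoras: the projections are self-adjoint and resolve the identity. -/
theorem IsProjectiveMeasurement.sum_frobeniusSq {F : Z → Matrix R R ℂ}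
    (hF : IsProjectiveMeasurement F) (M : Matrix R κ ℂ) :
    ∑ z, frobeniusSq (F z * M) = frobeniusSq M := by
  have h : ∀ z, frobeniusSq (F z * M) = ((Mᴴ * (F z * M)).trace).re := fun z => by
    rw [frobeniusSq_eq_re, conjTranspose_mul, (hF.isHermitian z).eq, Matrix.mul_assoc,
      ← Matrix.mul_assoc (F z), hF.mul_self]
  simp_rw [h]
  rw [← Complex.re_sum, ← Matrix.trace_sum, ← Matrix.mul_sum, ← Matrix.sum_mul, hF.sum_eq_one,
    Matrix.one_mul, ← frobeniusSq_eq_re]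

/-- The two-outcome measurement of a projection. -/
def yesNo (Q : Matrix R R ℂ) (z : Bool) : Matrix R R ℂ := if z then Q else 1 - Q

theorem isProjectiveMeasurement_yesNo {Q : Matrix R R ℂ} (hQ : Q.IsHermitian) (hQ2 : Q * Q = Q) :
    IsProjectiveMeasurement (yesNo Q) where
  isHermitian z := by
    cases z
    · exact isHermitian_one.sub hQ
    · exact hQ
  mul_self z := by
    cases z <;> simp [yesNo, Matrix.sub_mul, Matrix.mul_sub, hQ2]
  mul_of_ne z z' h := by
    cases z <;> cases z' <;> simp [yesNo, Matrix.sub_mul, Matrix.mul_sub, hQ2] at h ⊢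
  sum_eq_one := by simp [yesNo]

theorem frobeniusSq_mul_yesNo {Q : Matrix R R ℂ} (hQ : Q.IsHermitian) (hQ2 : Q * Q = Q)
    (M : Matrix κ R ℂ) :
    frobeniusSq (M * yesNo Q true) + frobeniusSq (M * yesNo Q false) = frobeniusSq M := by
  have hF := isProjectiveMeasurement_yesNo hQ hQ2
  have h := hF.sum_frobeniusSq Mᴴ
  have h2 : ∀ z, frobeniusSq (yesNo Q z * Mᴴ) = frobeniusSq (M * yesNo Q z) := fun z => by
    rw [← frobeniusSq_conjTranspose (M * _), conjTranspose_mul, (hF.isHermitian z).eq]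
  simpa [h2, frobeniusSq_conjTranspose] using h

end Projections

/-! ### Bit strings under addition modulo two -/

section Xor

variable {k : ℕ}

/-- Bitwise addition modulo two. -/
def bxor (s t : Bits k) : Bits k := fun i => xor (s i) (t i)

theorem bxor_comm (s t : Bits k) : bxor s t = bxor t s := funext fun _ => Bool.xor_comm _ _

@[simp] theorem bxor_zeros (s : Bits k) : bxor s (fun _ => false) = s :=
  funext fun _ => Bool.xor_false _

theorem bxor_self_left (s t : Bits k) : bxor s (bxor s t) = t :=
  funext fun i => by simp [bxor]

/-- Translation by a bit string. -/
def bxorEquiv (s : Bits k) : Bits k ≃ Bits k where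
  toFun := bxor s
  invFun := bxor s
  left_inv := bxor_self_left s
  right_inv := bxor_self_left s

/-- The characters of the group of bit strings. -/
noncomputable def character (s t : Bits k) : ℂ := ∏ i, if s i && t i then -1 else 1

theorem character_comm (s t : Bits k) : character s t = character t s := by
  simp only [character, Bool.and_comm]

theorem character_bxor (j s t : Bits k) :
    character j (bxor s t) = character j s * character j t := by
  unfold character
  rw [← Finset.prod_mul_distrib]
  refine Finset.prod_congr rfl fun i _ => ?_
  unfold bxor
  cases j i <;> cases s i <;> cases t i <;> simp

theorem character_mul_self (s t : Bits k) : character s t * character s t = 1 := by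
  rw [← character_bxor]
  simp [character, bxor]

theorem star_character (s t : Bits k) : star (character s t) = character s t := by
  unfold character
  rw [star_prod]
  refine Finset.prod_congr rfl fun i _ => ?_
  split_ifs <;> simp

theorem sum_character_mul (s t : Bits k) :
    ∑ j, character j s * character j t = if s = t then 2 ^ k else 0 := by
  have h : ∀ j : Bits k, character j s * character j t =
      ∏ i, (if j i && s i then -1 else 1) * (if j i && t i then (-1 : ℂ) else 1) := fun j => by
    rw [Finset.prod_mul_distrib]; rfl
  simp_rw [h]
  have h2 := Finset.prod_univ_sum (fun _ : Fin k => (Finset.univ : Finset Bool))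
    (fun i (b : Bool) => (if b && s i then -1 else 1) * (if b && t i then (-1 : ℂ) else 1))
  rw [Fintype.piFinset_univ] at h2
  rw [← h2]
  have h3 : ∀ i, (∑ b : Bool, (if b && s i then -1 else 1) * (if b && t i then (-1 : ℂ) else 1)) =
      if s i = t i then 2 else 0 := by
    intro i
    cases s i <;> cases t i <;> norm_num
  simp_rw [h3]
  split_ifs with hst
  · simp [hst]
  · obtain ⟨i, hi⟩ := Function.ne_iff.1 hst
    exact Finset.prod_eq_zero (Finset.mem_univ i) (by simp [hi])

end Xor

/-! ### Simultaneous measurement of commuting reflections -/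

section Spectral

variable {c : ℕ} {R : Type} [Fintype R]

/-- The projection on the joint eigenspace of the reflections `A` with signs given by `j`. -/
noncomputable def spectralProj (A : Bits c → Matrix R R ℂ) (j : Bits c) : Matrix R R ℂ :=
  ((2 : ℂ) ^ c)⁻¹ • ∑ s, character j s • A s

/-- The agreement of two simultaneous measurements on the maximally entangled state, in terms of
the reflections. -/
theorem sum_trace_spectralProj_mul (A B : Bits c → Matrix R R ℂ) :
    ∑ j, (spectralProj A j * spectralProj B j).trace =
      ((2 : ℂ) ^ c)⁻¹ * ∑ s, (A s * B s).trace := by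
  have h : ∀ j, (spectralProj A j * spectralProj B j).trace = ∑ s, ∑ t,
      ((2 : ℂ) ^ c)⁻¹ * ((2 : ℂ) ^ c)⁻¹ * (character j s * character j t) *
        (A s * B t).trace := by
    intro j
    unfold spectralProj
    rw [Matrix.smul_mul, Matrix.mul_smul, Matrix.trace_smul, Matrix.trace_smul, Matrix.sum_mul,
      Matrix.trace_sum, smul_eq_mul, smul_eq_mul, Finset.mul_sum, Finset.mul_sum]
    refine Finset.sum_congr rfl fun s _ => ?_
    rw [Matrix.mul_sum, Matrix.trace_sum, Finset.mul_sum, Finset.mul_sum]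
    refine Finset.sum_congr rfl fun t _ => ?_
    rw [Matrix.smul_mul, Matrix.mul_smul, Matrix.trace_smul, Matrix.trace_smul]
    simp only [smul_eq_mul]
    ring
  simp_rw [h]
  rw [Finset.sum_comm, Finset.mul_sum]
  refine Finset.sum_congr rfl fun s _ => ?_
  rw [Finset.sum_comm]
  -- Orthogonality of characters kills every term with `s ≠ t`.
  simp_rw [← Finset.sum_mul, ← Finset.mul_sum, sum_character_mul]
  rw [Finset.sum_eq_single s]
  · rw [if_pos rfl]; field_simp
  · intro t _ h; simp [h.symm]
  · simp

variable [DecidableEq R] {A : Bits c → Matrix R R ℂ}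

/-- A representation of the group of bit strings of length `c` by self-adjoint matrices. -/
structure IsReflectionGroup (A : Bits c → Matrix R R ℂ) : Prop where
  isHermitian : ∀ s, (A s).IsHermitian
  mul : ∀ s t, A s * A t = A (bxor s t)
  zero : A (fun _ => false) = 1

theorem IsReflectionGroup.mul_self (hA : IsReflectionGroup A) (s : Bits c) : A s * A s = 1 := by
  rw [hA.mul, ← hA.zero]
  congr 1
  funext i
  simp [bxor]

theorem IsReflectionGroup.mul_spectralProj (hA : IsReflectionGroup A) (s j : Bits c) :
    A s * spectralProj A j = character j s • spectralProj A j := by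
  unfold spectralProj
  rw [Matrix.mul_smul, smul_comm (character j s)]
  refine congrArg _ ?_
  rw [Matrix.mul_sum, Finset.smul_sum, ← (bxorEquiv s).sum_comp fun t => A s * character j t • A t]
  refine Finset.sum_congr rfl fun t _ => ?_
  change A s * character j (bxor s t) • A (bxor s t) = _
  rw [Matrix.mul_smul, hA.mul, smul_smul, bxor_self_left, character_bxor]

theorem IsReflectionGroup.isHermitian_spectralProj (hA : IsReflectionGroup A) (j : Bits c) :
    (spectralProj A j).IsHermitian := by
  unfold spectralProj Matrix.IsHermitian
  rw [conjTranspose_smul, conjTranspose_sum]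
  congr 1
  · simp
  · refine Finset.sum_congr rfl fun s _ => ?_
    rw [conjTranspose_smul, star_character, (hA.isHermitian s).eq]

theorem IsReflectionGroup.spectralProj_mul (hA : IsReflectionGroup A) (s j : Bits c) :
    spectralProj A j * A s = character j s • spectralProj A j := by
  have h := congrArg conjTranspose (hA.mul_spectralProj s j)
  rwa [conjTranspose_mul, conjTranspose_smul, star_character, (hA.isHermitian s).eq,
    (hA.isHermitian_spectralProj j).eq] at h

theorem IsReflectionGroup.isProjectiveMeasurement (hA : IsReflectionGroup A) :
    IsProjectiveMeasurement (spectralProj A) := by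
  have hmul : ∀ j j', spectralProj A j * spectralProj A j' =
      if j = j' then spectralProj A j' else 0 := by
    intro j j'
    conv_lhs => rw [spectralProj]
    rw [Matrix.smul_mul, Matrix.sum_mul]
    have h : ∀ s, (character j s • A s) * spectralProj A j' =
        (character s j * character s j') • spectralProj A j' := fun s => by
      rw [Matrix.smul_mul, hA.mul_spectralProj, smul_smul, character_comm j, character_comm j']
    rw [Finset.sum_congr rfl fun s _ => h s, ← Finset.sum_smul, sum_character_mul]
    split_ifs
    · rw [smul_smul, inv_mul_cancel₀ (pow_ne_zero _ two_ne_zero), one_smul]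
    · simp
  refine ⟨hA.isHermitian_spectralProj, fun j => by rw [hmul, if_pos rfl],
    fun j j' h => by rw [hmul, if_neg h], ?_⟩
  unfold spectralProj
  rw [← Finset.smul_sum, Finset.sum_comm]
  have h : ∀ s, ∑ j, character j s • A s =
      (if s = (fun _ => false) then (2 : ℂ) ^ c else 0) • A s := fun s => by
    rw [← sum_character_mul, ← Finset.sum_smul]
    congr 1
    refine Finset.sum_congr rfl fun j _ => ?_
    simp [character]
  rw [Finset.sum_congr rfl fun s _ => h s]
  simp [hA.zero, smul_smul]

/-- If both parties measure the same reflections, they agree at most as often as for one of the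
reflections. -/
theorem IsReflectionGroup.sum_frobeniusSq_le (hA : IsReflectionGroup A) (s : Bits c)
    (M : Matrix R R ℂ) :
    ∑ j, frobeniusSq (spectralProj A j * M * spectralProj A j) ≤
      (frobeniusSq M + ((Mᴴ * (A s * M * A s)).trace).re) / 2 := by
  have hF := hA.isProjectiveMeasurement
  -- `Y` is the part of `M` invariant under conjugation by `A s`. The agreeing outcomes see only
  -- `Y`, because the two factors `A s` contribute the same sign on both sides. So the agreement is
  -- at most the squared norm of `Y`.
  set Y : Matrix R R ℂ := (2 : ℂ)⁻¹ • (M + A s * M * A s) with hY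
  have h1 : ∀ j, spectralProj A j * M * spectralProj A j =
      spectralProj A j * Y * spectralProj A j := by
    intro j
    have h2 : spectralProj A j * (A s * M * A s) * spectralProj A j =
        spectralProj A j * M * spectralProj A j := by
      rw [Matrix.mul_assoc (A s), ← Matrix.mul_assoc, ← Matrix.mul_assoc, hA.spectralProj_mul,
        Matrix.mul_assoc _ (A s), hA.mul_spectralProj, Matrix.smul_mul, Matrix.mul_smul,
        Matrix.smul_mul, smul_smul, character_mul_self, one_smul]
    rw [hY, Matrix.mul_smul, Matrix.smul_mul, Matrix.mul_add, Matrix.add_mul, h2, ← two_smul ℂ,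
      smul_smul]
    norm_num
  have h3 : frobeniusSq Y = (frobeniusSq M + ((Mᴴ * (A s * M * A s)).trace).re) / 2 := by
    have hN : frobeniusSq (A s * M * A s) = frobeniusSq M := by
      rw [frobeniusSq_mul_unitary, frobeniusSq_unitary_mul]
      · rw [(hA.isHermitian s).eq, hA.mul_self]
      · rw [(hA.isHermitian s).eq, hA.mul_self]
    have hx : ((A s * M * A s)ᴴ * M).trace = star ((Mᴴ * (A s * M * A s)).trace) := by
      rw [← Matrix.trace_conjTranspose, conjTranspose_mul Mᴴ, conjTranspose_conjTranspose]
    set N := A s * M * A s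
    rw [frobeniusSq_eq_re] at hN
    rw [frobeniusSq_eq_re, hY, conjTranspose_smul, Matrix.smul_mul, Matrix.mul_smul,
      conjTranspose_add, Matrix.add_mul, Matrix.mul_add, Matrix.mul_add, smul_smul,
      Matrix.trace_smul, Matrix.trace_add, Matrix.trace_add, Matrix.trace_add, hx,
      show star (2 : ℂ)⁻¹ * (2 : ℂ)⁻¹ = ((1 / 4 : ℝ) : ℂ) by norm_num [Complex.ext_iff],
      smul_eq_mul, Complex.re_ofReal_mul]
    simp only [Complex.add_re, hN, ← frobeniusSq_eq_re, Complex.star_def, Complex.conj_re]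
    ring
  rw [← h3, ← hF.sum_frobeniusSq Y]
  refine Finset.sum_le_sum fun j _ => ?_
  rw [h1]
  have := frobeniusSq_mul_yesNo (hF.isHermitian j) (hF.mul_self j) (spectralProj A j * Y)
  have h0 := frobeniusSq_nonneg (spectralProj A j * Y * yesNo (spectralProj A j) false)
  simp only [yesNo, if_true] at this h0
  linarith

end Spectral

end EntanglementReduction

namespace EntanglementReduction

open Matrix

/-! ### Pauli strings -/

/-- Labels of the four Pauli matrices: the first bit tells whether the matrix flips, the second
whether it changes signs. -/
abbrev PauliLabel : Type := Bool × Bool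

/-- The label of the identity matrix. -/
abbrev PauliLabel.id : PauliLabel := (false, false)

/-- The Pauli matrices `1`, `X`, `Z` and `Y`. -/
noncomputable def pauli (w : PauliLabel) : Matrix Bool Bool ℂ := Matrix.of fun s t =>
  if xor s t = w.1 then
    (if w.2 && t then -1 else 1) * (if w.1 && w.2 then Complex.I else 1) else 0

theorem pauli_id : pauli PauliLabel.id = 1 := by
  ext s t
  cases s <;> cases t <;> simp [pauli]

theorem star_pauli (w : PauliLabel) (s t : Bool) : star (pauli w s t) = pauli w t s := by
  obtain ⟨u, v⟩ := w
  cases u <;> cases v <;> cases s <;> cases t <;> simp [pauli]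

theorem pauli_mul_self (w : PauliLabel) : pauli w * pauli w = 1 := by
  obtain ⟨u, v⟩ := w
  ext s t
  rw [Matrix.mul_apply, Fintype.sum_bool]
  cases u <;> cases v <;> cases s <;> cases t <;> simp [pauli]

theorem sum_pauli_mul_pauli (w w' : PauliLabel) :
    ∑ s, ∑ t, pauli w s t * pauli w' t s = if w = w' then 2 else 0 := by
  obtain ⟨u, v⟩ := w
  obtain ⟨u', v'⟩ := w'
  simp only [Fintype.sum_bool]
  cases u <;> cases v <;> cases u' <;> cases v' <;> simp [pauli] <;> norm_num

/-- Completeness: the Pauli matrices divided by `√2` are an orthonormal basis of the 2 × 2 matrices.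
-/
theorem sum_pauli_mul_star (s t s' t' : Bool) :
    ∑ w, pauli w s t * star (pauli w s' t') = if s = s' ∧ t = t' then 2 else 0 := by
  rw [Fintype.sum_prod_type]
  simp only [Fintype.sum_bool]
  cases s <;> cases t <;> cases s' <;> cases t' <;> simp [pauli] <;> norm_num

section Strings

variable {ι : Type} [Fintype ι] [DecidableEq ι]

/-- The tensor product of Pauli matrices. -/
noncomputable def pauliString (w : ι → PauliLabel) : Matrix (ι → Bool) (ι → Bool) ℂ :=
  Matrix.of fun s t => ∏ i, pauli (w i) (s i) (t i)

omit [DecidableEq ι] in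
theorem isHermitian_pauliString (w : ι → PauliLabel) : (pauliString w).IsHermitian := by
  ext s t
  simp only [conjTranspose_apply, pauliString, Matrix.of_apply, star_prod, star_pauli]

theorem sum_prod_eq_prod_sum {K A : Type} [Fintype K] [CommSemiring A] (f : ι → K → A) :
    ∑ s : ι → K, ∏ i, f i (s i) = ∏ i, ∑ b, f i b := by
  have h := Finset.prod_univ_sum (fun _ : ι => (Finset.univ : Finset K)) f
  rw [Fintype.piFinset_univ] at h
  exact h.symm

omit [DecidableEq ι] in
theorem prod_matrix_one (s t : ι → Bool) :
    (∏ i, (1 : Matrix Bool Bool ℂ) (s i) (t i)) = (1 : Matrix (ι → Bool) (ι → Bool) ℂ) s t := by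
  by_cases h : s = t
  · subst h
    rw [Matrix.one_apply_eq]
    exact Finset.prod_eq_one fun i _ => Matrix.one_apply_eq _
  · rw [Matrix.one_apply_ne h]
    obtain ⟨i, hi⟩ := Function.ne_iff.1 h
    exact Finset.prod_eq_zero (Finset.mem_univ i) (Matrix.one_apply_ne hi)

omit [DecidableEq ι] in
theorem pauliString_id : pauliString (fun _ : ι => PauliLabel.id) = 1 := by
  ext s t
  rw [← prod_matrix_one, pauliString, Matrix.of_apply, pauli_id]

theorem pauliString_mul_eq {u v w : ι → PauliLabel}
    (h : ∀ i, pauli (u i) * pauli (v i) = pauli (w i)) :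
    pauliString u * pauliString v = pauliString w := by
  ext s t
  simp only [pauliString, Matrix.mul_apply, Matrix.of_apply, ← Finset.prod_mul_distrib, ← h]
  exact sum_prod_eq_prod_sum fun i b => pauli (u i) (s i) b * pauli (v i) b (t i)

theorem pauliString_mul_self (w : ι → PauliLabel) : pauliString w * pauliString w = 1 := by
  rw [← pauliString_id]
  exact pauliString_mul_eq fun i => by rw [pauli_mul_self, pauli_id]

theorem trace_pauliString_mul (u v : ι → PauliLabel) :
    (pauliString u * pauliString v).trace = if u = v then 2 ^ Fintype.card ι else 0 := by
  have h : (pauliString u * pauliString v).trace =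
      ∏ i, ∑ s, ∑ t, pauli (u i) s t * pauli (v i) t s := by
    simp only [Matrix.trace, Matrix.diag_apply, Matrix.mul_apply, pauliString, Matrix.of_apply,
      ← Finset.prod_mul_distrib]
    rw [← sum_prod_eq_prod_sum fun i s => ∑ t, pauli (u i) s t * pauli (v i) t s]
    refine Finset.sum_congr rfl fun s _ => ?_
    exact sum_prod_eq_prod_sum fun i t => pauli (u i) (s i) t * pauli (v i) t (s i)
  rw [h]
  simp_rw [sum_pauli_mul_pauli]
  split_ifs with huv
  · simp [huv]
  · obtain ⟨i, hi⟩ := Function.ne_iff.1 huv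
    exact Finset.prod_eq_zero (Finset.mem_univ i) (by simp [hi])

/-- The labels of the Pauli strings that act as the identity outside of `B`. -/
def labelsOn (B : Finset ι) : Finset (ι → PauliLabel) :=
  Fintype.piFinset fun i => if i ∈ B then Finset.univ else {PauliLabel.id}

theorem mem_labelsOn {B : Finset ι} {w : ι → PauliLabel} :
    w ∈ labelsOn B ↔ ∀ i, i ∉ B → w i = PauliLabel.id := by
  rw [labelsOn, Fintype.mem_piFinset]
  refine forall_congr' fun i => ?_
  by_cases h : i ∈ B <;> simp [h]

theorem card_labelsOn (B : Finset ι) : (labelsOn B).card = 4 ^ B.card := by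
  rw [labelsOn, Fintype.card_piFinset]
  have h : ∀ i, (if i ∈ B then Finset.univ else {PauliLabel.id} : Finset PauliLabel).card =
      if i ∈ B then 4 else 1 := fun i => by
    split_ifs <;> rfl
  simp_rw [h]
  rw [Finset.prod_ite_mem, Finset.univ_inter, Finset.prod_const]

/-! ### Bessel's inequality for Pauli strings supported on a set of qubits -/

/-- The factors of `pauliKernel`. -/
def pauliKernelFactor (p : Prop) [Decidable p] (a b c d : Bool) : ℝ :=
  if p then (if a = c ∧ b = d then 2 else 0) else (if a = b ∧ c = d then 1 else 0)

/-- The kernel `∑ P ⊗ conj P` over all Pauli strings `P` that act as the identity outside of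
`B`. -/
def pauliKernel (B : Finset ι) (a b c d : ι → Bool) : ℝ :=
  ∏ i, pauliKernelFactor (i ∈ B) (a i) (b i) (c i) (d i)

theorem pauliKernel_nonneg (B : Finset ι) (a b c d : ι → Bool) : 0 ≤ pauliKernel B a b c d :=
  Finset.prod_nonneg fun i _ => by unfold pauliKernelFactor; split_ifs <;> norm_num

theorem sum_pauliString_mul_star (B : Finset ι) (a b c d : ι → Bool) :
    ∑ w ∈ labelsOn B, pauliString w a b * star (pauliString w c d) = pauliKernel B a b c d := by
  simp only [pauliString, Matrix.of_apply, star_prod, ← Finset.prod_mul_distrib, labelsOn,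
    pauliKernel, Complex.ofReal_prod]
  rw [← Finset.prod_univ_sum _ fun i w => pauli w (a i) (b i) * star (pauli w (c i) (d i))]
  refine Finset.prod_congr rfl fun i _ => ?_
  unfold pauliKernelFactor
  by_cases h : i ∈ B
  · simp only [h, if_true, sum_pauli_mul_star]
    split_ifs <;> norm_num
  · simp only [h, if_false, Finset.sum_singleton, pauli_id, Matrix.one_apply]
    by_cases h1 : a i = b i <;> by_cases h2 : c i = d i <;> simp [h1, h2]

/-- Given `a` and `d`, each coordinate allows exactly one pair `(b, c)`: `(d, a)` with weight 2
inside `B`, and `(a, d)` with weight 1 outside. -/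
theorem sum_pauliKernel (B : Finset ι) (a d : ι → Bool) :
    ∑ b, ∑ c, pauliKernel B a b c d = 2 ^ B.card := by
  have h : ∀ b, ∑ c, pauliKernel B a b c d =
      ∏ i, ∑ s, pauliKernelFactor (i ∈ B) (a i) (b i) s (d i) := fun b =>
    sum_prod_eq_prod_sum fun i s => pauliKernelFactor (i ∈ B) (a i) (b i) s (d i)
  simp_rw [h]
  rw [sum_prod_eq_prod_sum fun i t => ∑ s, pauliKernelFactor (i ∈ B) (a i) t s (d i)]
  have h2 : ∀ i, (∑ t, ∑ s, pauliKernelFactor (i ∈ B) (a i) t s (d i)) =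
      if i ∈ B then 2 else 1 := by
    intro i
    simp only [Fintype.sum_bool, pauliKernelFactor]
    cases a i <;> cases d i <;> split_ifs <;> simp_all
  simp_rw [h2]
  rw [Finset.prod_ite_mem, Finset.univ_inter, Finset.prod_const]

theorem sum_pauliKernel' (B : Finset ι) (b c : ι → Bool) :
    ∑ a, ∑ d, pauliKernel B a b c d = 2 ^ B.card := by
  rw [← sum_pauliKernel B b c]
  refine Finset.sum_congr rfl fun a _ => Finset.sum_congr rfl fun d _ =>
    Finset.prod_congr rfl fun i _ => ?_
  unfold pauliKernelFactor
  split_ifs <;> simp_all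

/-- A Bessel inequality for the Pauli strings that act as the identity outside of `B`. -/
theorem sum_norm_pauliString_sq_le (B : Finset ι) (f g : (ι → Bool) → ℂ) :
    ∑ w ∈ labelsOn B, ‖∑ a, ∑ b, f a * pauliString w a b * g b‖ ^ 2 ≤
      2 ^ B.card * (∑ a, ‖f a‖ ^ 2) * ∑ b, ‖g b‖ ^ 2 := by
  have h1 : ((∑ w ∈ labelsOn B, ‖∑ a, ∑ b, f a * pauliString w a b * g b‖ ^ 2 : ℝ) : ℂ) =
      ∑ a, ∑ b, ∑ c, ∑ d, f a * g b * star (f c) * star (g d) * (pauliKernel B a b c d : ℂ) := by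
    have h : ∀ w : ι → PauliLabel, ((‖∑ a, ∑ b, f a * pauliString w a b * g b‖ ^ 2 : ℝ) : ℂ) =
        ∑ a, ∑ b, ∑ c, ∑ d, f a * g b * star (f c) * star (g d) *
          (pauliString w a b * star (pauliString w c d)) := by
      intro w
      rw [Complex.ofReal_pow, ← Complex.mul_conj', ← Complex.star_def, Finset.sum_mul]
      refine Finset.sum_congr rfl fun a _ => ?_
      rw [Finset.sum_mul]
      refine Finset.sum_congr rfl fun b _ => ?_
      rw [star_sum, Finset.mul_sum]
      refine Finset.sum_congr rfl fun c _ => ?_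
      rw [star_sum, Finset.mul_sum]
      refine Finset.sum_congr rfl fun d _ => ?_
      rw [star_mul', star_mul']
      ring
    simp only [Complex.ofReal_sum, h]
    simp only [← sum_pauliString_mul_star, Finset.mul_sum]
    rw [Finset.sum_comm]
    refine Finset.sum_congr rfl fun a _ => ?_
    rw [Finset.sum_comm]
    refine Finset.sum_congr rfl fun b _ => ?_
    rw [Finset.sum_comm]
    refine Finset.sum_congr rfl fun c _ => ?_
    rw [Finset.sum_comm]
  -- Schur test for the nonnegative kernel. The pairing `(a, d)`, `(b, c)` in the AM-GM step is
  -- chosen because the kernel has marginal `2 ^ |B|` for both of these pairs; outside `B` the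
  -- indices `a, b` are tied together, and inside `B` the indices `a, c` are, so other pairings lose
  -- a factor.
  have h2 : ∑ w ∈ labelsOn B, ‖∑ a, ∑ b, f a * pauliString w a b * g b‖ ^ 2 ≤
      ∑ a, ∑ b, ∑ c, ∑ d, ((‖f a‖ ^ 2 * ‖g d‖ ^ 2) / 2 + (‖f c‖ ^ 2 * ‖g b‖ ^ 2) / 2) *
        pauliKernel B a b c d := by
    rw [← Complex.ofReal_re (∑ w ∈ labelsOn B, _), h1]
    simp only [Complex.re_sum]
    refine Finset.sum_le_sum fun a _ => Finset.sum_le_sum fun b _ =>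
        Finset.sum_le_sum fun c _ => Finset.sum_le_sum fun d _ => ?_
    rw [Complex.re_mul_ofReal]
    refine mul_le_mul_of_nonneg_right ?_ (pauliKernel_nonneg _ _ _ _ _)
    refine (Complex.re_le_norm _).trans ?_
    rw [norm_mul, norm_mul, norm_mul, norm_star, norm_star]
    nlinarith [sq_nonneg (‖f a‖ * ‖g d‖ - ‖f c‖ * ‖g b‖)]
  refine h2.trans (le_of_eq ?_)
  simp only [add_mul, Finset.sum_add_distrib]
  have h3 : ∑ a, ∑ b, ∑ c, ∑ d, (‖f a‖ ^ 2 * ‖g d‖ ^ 2) / 2 * pauliKernel B a b c d =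
      2 ^ B.card * (∑ a, ‖f a‖ ^ 2) * (∑ b, ‖g b‖ ^ 2) / 2 := by
    have : ∀ a, ∑ b, ∑ c, ∑ d, (‖f a‖ ^ 2 * ‖g d‖ ^ 2) / 2 * pauliKernel B a b c d =
        ∑ d, (‖f a‖ ^ 2 * ‖g d‖ ^ 2) / 2 * 2 ^ B.card := by
      intro a
      rw [Finset.sum_congr rfl fun b _ => Finset.sum_comm, Finset.sum_comm]
      refine Finset.sum_congr rfl fun d _ => ?_
      simp_rw [← sum_pauliKernel B a d, Finset.mul_sum]
    simp_rw [this, ← Finset.sum_mul, ← Finset.sum_div, ← Finset.mul_sum, ← Finset.sum_mul]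
    ring
  have h4 : ∑ a, ∑ b, ∑ c, ∑ d, (‖f c‖ ^ 2 * ‖g b‖ ^ 2) / 2 * pauliKernel B a b c d =
      2 ^ B.card * (∑ a, ‖f a‖ ^ 2) * (∑ b, ‖g b‖ ^ 2) / 2 := by
    have : ∀ b c, ∑ a, ∑ d, (‖f c‖ ^ 2 * ‖g b‖ ^ 2) / 2 * pauliKernel B a b c d =
        (‖f c‖ ^ 2 * ‖g b‖ ^ 2) / 2 * 2 ^ B.card := by
      intro b c
      simp_rw [← sum_pauliKernel' B b c, Finset.mul_sum]
    rw [Finset.sum_comm]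
    have h5 : ∀ b, ∑ a, ∑ c, ∑ d, (‖f c‖ ^ 2 * ‖g b‖ ^ 2) / 2 * pauliKernel B a b c d =
        ∑ c, (‖f c‖ ^ 2 * ‖g b‖ ^ 2) / 2 * 2 ^ B.card := by
      intro b
      rw [Finset.sum_comm]
      exact Finset.sum_congr rfl fun c _ => this b c
    simp_rw [h5, ← Finset.sum_mul, ← Finset.sum_div, ← Finset.sum_mul, ← Finset.mul_sum]
    ring
  rw [h3, h4]
  ring

end Strings

end EntanglementReduction

namespace EntanglementReduction

open Matrix

/-! ### Measurements that are recorded in a register -/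

section Record

variable {k : ℕ} {R : Type} [Fintype R] [DecidableEq R]

/-- The operation that adds the outcome of the measurement `F` to a register of `k` qubits. -/
def recordMatrix (F : Bits k → Matrix R R ℂ) : Matrix (R × Bits k) (R × Bits k) ℂ :=
  Matrix.of fun p q => F (bxor p.2 q.2) p.1 q.1

/-- The matrix is Hermitian and squares to 1: the block `(s, s')` of the square is `∑ t, F (s + t) *
F (t + s')`, which is `∑ F = 1` for `s = s'` and vanishes otherwise, since then the two outcomes
differ. -/
theorem recordMatrix_mem_unitaryGroup {F : Bits k → Matrix R R ℂ}
    (hF : IsProjectiveMeasurement F) : recordMatrix F ∈ Matrix.unitaryGroup (R × Bits k) ℂ := by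
  have hH : (recordMatrix F)ᴴ = recordMatrix F := by
    ext p q
    rw [conjTranspose_apply, recordMatrix, Matrix.of_apply, Matrix.of_apply, bxor_comm,
      ← (hF.isHermitian _).apply]
    simp
  rw [Matrix.mem_unitaryGroup_iff, Matrix.star_eq_conjTranspose, hH]
  ext ⟨r, s⟩ ⟨r', s'⟩
  rw [Matrix.mul_apply, Fintype.sum_prod_type_right]
  have h : ∀ t : Bits k, (∑ x, recordMatrix F (r, s) (x, t) * recordMatrix F (x, t) (r', s')) =
      if s = s' then F (bxor s t) r r' else 0 := by
    intro t
    have : (∑ x, recordMatrix F (r, s) (x, t) * recordMatrix F (x, t) (r', s')) =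
        (F (bxor s t) * F (bxor t s')) r r' := rfl
    rw [this, bxor_comm t s']
    split_ifs with hs
    · rw [hs, hF.mul_self]
    · rw [hF.mul_of_ne]
      · rfl
      · intro h
        apply hs
        have := congrArg (bxor t) h
        rwa [bxor_comm s, bxor_comm s', bxor_self_left, bxor_self_left] at this
  simp_rw [h]
  rw [Matrix.one_apply]
  by_cases hs : s = s'
  · simp only [hs, if_true]
    have h2 := (bxorEquiv s').sum_comp fun t => F t r r'
    change ∑ t, F (bxor s' t) r r' = _ at h2
    rw [h2, ← Matrix.sum_apply, hF.sum_eq_one,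
      Matrix.one_apply]
    simp
  · simp [hs]

end Record

theorem submatrix_mem_unitaryGroup {α β : Type} [Fintype α] [Fintype β] [DecidableEq α]
    [DecidableEq β] (e : α ≃ β) {U : Matrix β β ℂ} (hU : U ∈ Matrix.unitaryGroup β ℂ) :
    U.submatrix e e ∈ Matrix.unitaryGroup α ℂ := by
  rw [Matrix.mem_unitaryGroup_iff, Matrix.star_eq_conjTranspose] at hU ⊢
  rw [conjTranspose_submatrix, Matrix.submatrix_mul_equiv, hU, Matrix.submatrix_one_equiv]

theorem IsProjectiveMeasurement.comp_equiv {Z Z' R : Type} [Fintype Z] [Fintype Z'] [Fintype R]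
    [DecidableEq R] {F : Z → Matrix R R ℂ} (hF : IsProjectiveMeasurement F) (e : Z' ≃ Z) :
    IsProjectiveMeasurement (F ∘ e) where
  isHermitian z := hF.isHermitian _
  mul_self z := hF.mul_self _
  mul_of_ne z z' h := hF.mul_of_ne _ _ fun h' => h (e.injective h')
  sum_eq_one := by
    rw [← hF.sum_eq_one]
    exact e.sum_comp F

/-! ### The protocol in which both parties measure and compare outcomes -/

section Compare

variable {n m c : ℕ}

/-- Alice's share of the prior state and her message register. -/
def aliceRegEquiv : AliceReg m 0 c ≃ Bits m × Bits c where
  toFun p := (p.1, p.2.2)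
  invFun p := (p.1, fun _ => false, p.2)
  left_inv p := by
    ext1
    · rfl
    · exact Prod.ext (Subsingleton.elim _ _) rfl
  right_inv _ := rfl

/-- Bob's registers, with the work qubit separated from the others. -/
def bobRegEquiv : BobReg m 1 c ≃ (Bits m × Bits c) × Bits 1 where
  toFun p := ((p.2.1, p.1), p.2.2)
  invFun p := (p.1.2, p.1.1, p.2)
  left_inv _ := rfl
  right_inv _ := rfl

/-- Bob's projection: his measurement of the prior state agrees with the message. -/
def agreeProj (F : Bits c → Matrix (Bits m) (Bits m) ℂ) :
    Matrix (Bits m × Bits c) (Bits m × Bits c) ℂ :=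
  Matrix.blockDiagonal fun j => (F j)ᵀ

theorem isHermitian_agreeProj {F : Bits c → Matrix (Bits m) (Bits m) ℂ}
    (hF : IsProjectiveMeasurement F) : (agreeProj F).IsHermitian := by
  unfold agreeProj Matrix.IsHermitian
  rw [Matrix.blockDiagonal_conjTranspose]
  congr 1
  funext j
  exact (hF.isHermitian j).transpose

theorem agreeProj_mul_self {F : Bits c → Matrix (Bits m) (Bits m) ℂ}
    (hF : IsProjectiveMeasurement F) : agreeProj F * agreeProj F = agreeProj F := by
  unfold agreeProj
  rw [← Matrix.blockDiagonal_mul]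
  congr 1
  funext j
  rw [← Matrix.transpose_mul, hF.mul_self]

theorem yesNo_agreeProj_apply (F : Bits c → Matrix (Bits m) (Bits m) ℂ) (z : Bool)
    (r r' : Bits m) (j j' : Bits c) :
    yesNo (agreeProj F) z (r, j) (r', j') = if j = j' then yesNo (F j) z r' r else 0 := by
  cases z
  · simp only [yesNo, agreeProj, Bool.false_eq_true, if_false, Matrix.sub_apply,
      Matrix.blockDiagonal_apply, Matrix.one_apply, Prod.mk.injEq, Matrix.transpose_apply]
    by_cases h : j = j' <;> simp [h, eq_comm]
  · simp only [yesNo, agreeProj, if_true, Matrix.blockDiagonal_apply, Matrix.transpose_apply]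

/-- The measurement of the work qubit of Bob. -/
def workQubitMeasurement (m c : ℕ) : VonNeumannMeasurement (BobReg m 1 c) Bool where
  proj z := Matrix.diagonal fun q => if q.2.2 0 = z then 1 else 0
  isHermitian z := by
    refine Matrix.isHermitian_diagonal_of_self_adjoint _ ?_
    ext q
    by_cases h : q.2.2 0 = z <;> simp [h]
  idempotent z := by
    rw [Matrix.diagonal_mul_diagonal]
    congr 1
    funext q
    split_ifs <;> simp
  sum_eq_one := by
    rw [Fintype.sum_bool, Matrix.diagonal_add, ← Matrix.diagonal_one]
    congr 1
    funext q
    cases q.2.2 0 <;> simp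

/-- Alice measures her share of the prior state by `F x` and sends the outcome. Bob checks whether
his measurement, the transpose of `F y`, has the same outcome. -/
noncomputable def compareOperations (F : Bits n → Bits c → Matrix (Bits m) (Bits m) ℂ)
    (hF : ∀ x, IsProjectiveMeasurement (F x)) : OneRoundOperations n m 0 1 c Bool where
  alice x := ⟨(recordMatrix (F x)).submatrix aliceRegEquiv aliceRegEquiv,
    submatrix_mem_unitaryGroup _ (recordMatrix_mem_unitaryGroup (hF x))⟩
  bob y := ⟨(recordMatrix (yesNo (agreeProj (F y)) ∘ Equiv.funUnique (Fin 1) Bool)).submatrix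
      bobRegEquiv bobRegEquiv,
    submatrix_mem_unitaryGroup _ (recordMatrix_mem_unitaryGroup
      ((isProjectiveMeasurement_yesNo (isHermitian_agreeProj (hF y))
        (agreeProj_mul_self (hF y))).comp_equiv _))⟩
  meas := workQubitMeasurement m c

variable {F : Bits n → Bits c → Matrix (Bits m) (Bits m) ℂ}
  {hF : ∀ x, IsProjectiveMeasurement (F x)}

theorem afterAlice_compareOperations {P : OneRoundProtocol n m 0 1 c Bool}
    (hP : P.ops = compareOperations F hF) (x : Bits n) (r : Bits m) (u : Bits 0) (j : Bits c)
    (s : Bits m) (t : Bits 1) :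
    P.afterAlice x (r, u, j) (s, t) =
      if t = (fun _ => false) then (F x j * coeffMatrix P.prior) r s else 0 := by
  unfold OneRoundProtocol.afterAlice
  rw [hP, ← aliceRegEquiv.symm.sum_comp, Fintype.sum_prod_type]
  have h : ∀ (r' : Bits m) (j' : Bits c),
      (((compareOperations F hF).alice x : Matrix (AliceReg m 0 c) (AliceReg m 0 c) ℂ) (r, u, j)
        (aliceRegEquiv.symm (r', j'))) * P.initial (aliceRegEquiv.symm (r', j')) (s, t) =
      if j' = (fun _ => false) then
        (if t = (fun _ => false) then F x j r r' * coeffMatrix P.prior r' s else 0) else 0 := by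
    intro r' j'
    have h1 : ((compareOperations F hF).alice x : Matrix (AliceReg m 0 c) (AliceReg m 0 c) ℂ)
        (r, u, j) (aliceRegEquiv.symm (r', j')) = F x (bxor j j') r r' := rfl
    have h2 : P.initial (aliceRegEquiv.symm (r', j')) (s, t) =
        if j' = (fun _ => false) ∧ t = (fun _ => false) then coeffMatrix P.prior r' s else 0 := by
      simp [OneRoundProtocol.initial, aliceRegEquiv, coeffMatrix]
    rw [h1, h2]
    by_cases hj : j' = (fun _ => false) <;> by_cases ht : t = (fun _ => false) <;> simp [hj, ht]
  simp only [h, Finset.sum_ite_eq', Finset.mem_univ, if_true]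
  split_ifs <;> simp [Matrix.mul_apply]

/-- Bob's projections are transposed, so that they act on the coefficient matrix by right
multiplication with `F y j`. The formula holds for every prior state, as is needed for similar
protocols. -/
theorem outputProb_compareOperations {P : OneRoundProtocol n m 0 1 c Bool}
    (hP : P.ops = compareOperations F hF) (x y : Bits n) (z : Bool) :
    P.outputProb x y z = ∑ j, frobeniusSq (F x j * coeffMatrix P.prior * yesNo (F y j) z) := by
  unfold OneRoundProtocol.outputProb
  refine Finset.sum_congr rfl fun j _ => ?_
  rw [Fintype.sum_prod_type, frobeniusSq]
  refine Finset.sum_congr rfl fun r _ => ?_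
  refine (Finset.sum_congr rfl fun u _ => (?_ : _ = ∑ s,
    ‖(F x j * coeffMatrix P.prior * yesNo (F y j) z) r s‖ ^ 2)).trans (by simp)
  rw [← bobRegEquiv.symm.sum_comp, Fintype.sum_prod_type, Fintype.sum_prod_type]
  refine Finset.sum_congr rfl fun s _ => ?_
  -- The work qubit starts at 0 and receives Bob's verdict, so its value `t 0` in the result names
  -- the branch of the yes/no measurement.
  have hb : ∀ (j' : Bits c) (t : Bits 1),
      ((P.ops.bob y : Matrix (BobReg m 1 c) (BobReg m 1 c) ℂ) *ᵥ
        P.afterMessage x j (r, u)) (j', s, t) =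
      if j' = j then (F x j * coeffMatrix P.prior * yesNo (F y j) (t 0)) r s else 0 := by
    intro j' t
    rw [Matrix.mulVec, dotProduct, ← bobRegEquiv.symm.sum_comp, Fintype.sum_prod_type,
      Fintype.sum_prod_type]
    have h : ∀ (r' : Bits m) (j₁ : Bits c) (t' : Bits 1),
        (P.ops.bob y : Matrix (BobReg m 1 c) (BobReg m 1 c) ℂ) (j', s, t)
            (bobRegEquiv.symm ((r', j₁), t')) *
          P.afterMessage x j (r, u) (bobRegEquiv.symm ((r', j₁), t')) =
        if t' = (fun _ => false) then (if j₁ = j then (if j' = j then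
          (F x j * coeffMatrix P.prior) r r' * yesNo (F y j) (t 0) r' s else 0) else 0) else 0 := by
      intro r' j₁ t'
      have h1 : (P.ops.bob y : Matrix (BobReg m 1 c) (BobReg m 1 c) ℂ) (j', s, t)
            (bobRegEquiv.symm ((r', j₁), t')) =
          if j' = j₁ then yesNo (F y j') (bxor t t' 0) r' s else 0 := by
        rw [hP, ← yesNo_agreeProj_apply]
        rfl
      have h2 : P.afterMessage x j (r, u) (bobRegEquiv.symm ((r', j₁), t')) =
          if j₁ = j then (if t' = (fun _ => false) then
            (F x j * coeffMatrix P.prior) r r' else 0) else 0 := by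
        rw [← afterAlice_compareOperations hP x r u j r' t']
        rfl
      rw [h1, h2]
      by_cases hj : j₁ = j
      · subst hj
        by_cases ht : t' = (fun _ => false)
        · subst ht
          by_cases hj' : j' = j₁
          · subst hj'
            simp [mul_comm]
          · simp [hj']
        · simp [ht]
      · simp [hj]
    simp only [h, Finset.sum_ite_eq', Finset.mem_univ, if_true]
    split_ifs <;> simp [Matrix.mul_apply]
  have hz : ∀ (j' : Bits c) (t : Bits 1),
      ‖(P.ops.meas.proj z *ᵥ ((P.ops.bob y : Matrix (BobReg m 1 c) (BobReg m 1 c) ℂ) *ᵥ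
        P.afterMessage x j (r, u))) (bobRegEquiv.symm ((s, j'), t))‖ ^ 2 =
      if j' = j then (if t = (fun _ => z) then
        ‖(F x j * coeffMatrix P.prior * yesNo (F y j) z) r s‖ ^ 2 else 0) else 0 := by
    intro j' t
    have h1 : P.ops.meas.proj z =
        Matrix.diagonal fun q : BobReg m 1 c => if q.2.2 0 = z then (1 : ℂ) else 0 := by
      rw [hP]; rfl
    rw [h1, Matrix.mulVec_diagonal]
    change ‖(if t 0 = z then (1 : ℂ) else 0) * ((P.ops.bob y : Matrix _ _ ℂ) *ᵥ
        P.afterMessage x j (r, u)) (j', s, t)‖ ^ 2 = _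
    rw [hb]
    have ht : t = (fun _ => z) ↔ t 0 = z :=
      ⟨fun h => by rw [h], fun h => funext fun i => by rw [Subsingleton.elim i 0, h]⟩
    by_cases hj : j' = j <;> by_cases htz : t 0 = z <;> simp [hj, ht, htz]
  rw [Finset.sum_congr rfl fun j' _ => Finset.sum_congr rfl fun t _ => hz j' t]
  rw [Finset.sum_eq_single j (fun j' _ hj => by simp [hj]) (by simp)]
  rw [Finset.sum_eq_single (fun _ => z) (fun t _ ht => by simp [ht]) (by simp), if_pos rfl,
    if_pos rfl]

end Compare

end EntanglementReduction

namespace EntanglementReduction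

open Matrix

/-! ### Measurements of blocks of qubits in Pauli bases -/

section Blocks

variable {ι : Type} [Fintype ι] {c : ℕ}

/-- The labels `w` restricted to the blocks selected by `s`. -/
def maskLabel (β : ι → Fin c) (w : ι → PauliLabel) (s : Bits c) (i : ι) : PauliLabel :=
  if s (β i) then w i else PauliLabel.id

/-- On each qubit only the identity and one fixed Pauli matrix occur, so these strings commute and
multiply without phases. -/
theorem isReflectionGroup_maskLabel [DecidableEq ι] (β : ι → Fin c) (w : ι → PauliLabel) :
    IsReflectionGroup fun s => pauliString (maskLabel β w s) where
  isHermitian s := isHermitian_pauliString _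
  mul s t := by
    refine pauliString_mul_eq fun i => ?_
    unfold maskLabel bxor
    cases s (β i) <;> cases t (β i) <;> simp [pauli_id, pauli_mul_self]
  zero := by
    rw [← pauliString_id]
    congr 1

/-- If two labellings differ in two blocks, then at most a quarter of the masks identify them. -/
theorem card_maskLabel_eq_le {β : ι → Fin 4} {v w : ι → PauliLabel} {i j : ι} (hij : β i ≠ β j)
    (hi : v i ≠ w i) (hj : v j ≠ w j) :
    ∑ s, (if maskLabel β v s = maskLabel β w s then (1 : ℝ) else 0) ≤ 4 := by
  -- A mask that identifies `v` and `w` must omit both blocks in which they differ; this leaves `2 ^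
  -- 2` of the `2 ^ 4` masks.
  have h : ∀ s, (if maskLabel β v s = maskLabel β w s then (1 : ℝ) else 0) ≤
      if s (β i) = false ∧ s (β j) = false then 1 else 0 := by
    intro s
    split_ifs with h1 h2 h2
    · exact le_rfl
    · exfalso
      have hi' := congrFun h1 i
      have hj' := congrFun h1 j
      unfold maskLabel at hi' hj'
      cases hs : s (β i) <;> cases hs' : s (β j) <;> simp_all
    · norm_num
    · exact le_rfl
  refine (Finset.sum_le_sum fun s _ => h s).trans ?_
  rw [Finset.sum_boole]
  have : ∀ a b : Fin 4, a ≠ b → (Finset.univ.filter fun s : Bits 4 =>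
      s a = false ∧ s b = false).card = 4 := by decide
  rw [this _ _ hij]
  norm_num

end Blocks

/-! ### Entanglement given by EPR pairs -/

section EPR

variable {n m c : ℕ}

theorem coeffMatrix_eprPairs (m : ℕ) :
    coeffMatrix (eprPairs m) = ((1 / ((√2 : ℝ) : ℂ)) ^ m) • (1 : Matrix (Bits m) (Bits m) ℂ) := by
  ext s t
  change ∏ i, eprPair (s i) (t i) = _
  rw [Matrix.smul_apply, ← prod_matrix_one, smul_eq_mul]
  have h : ∀ i, eprPair (s i) (t i) =
      1 / ((√2 : ℝ) : ℂ) * (1 : Matrix Bool Bool ℂ) (s i) (t i) := fun i => by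
    rw [eprPair, Matrix.one_apply]
    split_ifs <;> simp
  simp_rw [h]
  rw [Finset.prod_mul_distrib, Finset.prod_const, Finset.card_univ, Fintype.card_fin]

theorem frobeniusSq_smul {α β : Type} [Fintype α] [Fintype β] (z : ℂ) (M : Matrix α β ℂ) :
    frobeniusSq (z • M) = ‖z‖ ^ 2 * frobeniusSq M := by
  simp only [frobeniusSq, Matrix.smul_apply, norm_smul, mul_pow, ← Finset.mul_sum]

theorem norm_eprAmplitude_sq (m : ℕ) : ‖(1 / ((√2 : ℝ) : ℂ)) ^ m‖ ^ 2 = ((2 : ℝ) ^ m)⁻¹ := by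
  rw [norm_pow, norm_div, norm_one, Complex.norm_real, Real.norm_of_nonneg (Real.sqrt_nonneg _),
    ← pow_mul, mul_comm m, pow_mul, div_pow, Real.sq_sqrt zero_le_two, one_pow, one_div, inv_pow]

theorem norm_sq_eq_frobeniusSq {α β : Type} [Fintype α] [Fintype β]
    (φ : EuclideanSpace ℂ (α × β)) : ‖φ‖ ^ 2 = frobeniusSq (coeffMatrix φ) := by
  rw [EuclideanSpace.norm_sq_eq, Fintype.sum_prod_type]
  rfl

theorem norm_eprPairs (m : ℕ) : ‖eprPairs m‖ = 1 := by
  have h : frobeniusSq (1 : Matrix (Bits m) (Bits m) ℂ) = 2 ^ m := by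
    rw [frobeniusSq_eq_re]
    simp only [conjTranspose_one, Matrix.mul_one, Matrix.trace_one, Fintype.card_fun,
      Fintype.card_bool, Fintype.card_fin]
    norm_cast
  rw [← sq_eq_sq₀ (norm_nonneg _) zero_le_one, norm_sq_eq_frobeniusSq, coeffMatrix_eprPairs,
    frobeniusSq_smul, norm_eprAmplitude_sq, h]
  simp

variable {F : Bits n → Bits c → Matrix (Bits m) (Bits m) ℂ}
  {hF : ∀ x, IsProjectiveMeasurement (F x)} {P : OneRoundProtocol n m 0 1 c Bool}

theorem outputProb_true_add_false (hP : P.ops = compareOperations F hF) (x y : Bits n) :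
    P.outputProb x y true + P.outputProb x y false = 1 := by
  rw [outputProb_compareOperations hP, outputProb_compareOperations hP, ← Finset.sum_add_distrib]
  simp_rw [frobeniusSq_mul_yesNo ((hF y).isHermitian _) ((hF y).mul_self _)]
  rw [(hF x).sum_frobeniusSq, ← norm_sq_eq_frobeniusSq, P.norm_prior, one_pow]

/-- With `M` a multiple of the identity, the norm of `F x j * F y j` reduces to a trace by
idempotence and cyclicity. -/
theorem outputProb_true_eprPairs (hP : P.ops = compareOperations F hF)
    (hφ : P.prior = eprPairs m) (x y : Bits n) :
    P.outputProb x y true = ((2 : ℝ) ^ m)⁻¹ * (∑ j, (F x j * F y j).trace).re := by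
  rw [outputProb_compareOperations hP, hφ, coeffMatrix_eprPairs, Complex.re_sum, Finset.mul_sum]
  refine Finset.sum_congr rfl fun j _ => ?_
  rw [Matrix.mul_smul, Matrix.mul_one, Matrix.smul_mul, frobeniusSq_smul, norm_eprAmplitude_sq,
    frobeniusSq_eq_re, yesNo, if_pos rfl, conjTranspose_mul, ((hF x).isHermitian j).eq,
    ((hF y).isHermitian j).eq, Matrix.mul_assoc, ← Matrix.mul_assoc (F x j), (hF x).mul_self,
    Matrix.trace_mul_comm, Matrix.mul_assoc, (hF y).mul_self]

theorem outputProb_false_eprPairs_self (hP : P.ops = compareOperations F hF)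
    (hφ : P.prior = eprPairs m) (x : Bits n) : P.outputProb x x false = 0 := by
  rw [outputProb_compareOperations hP, hφ, coeffMatrix_eprPairs]
  refine Finset.sum_eq_zero fun j _ => ?_
  rw [Matrix.mul_smul, Matrix.mul_one, Matrix.smul_mul, frobeniusSq_smul, yesNo]
  simp [Matrix.mul_sub, (hF x).mul_self, frobeniusSq]

end EPR

/-! ### Encoding inputs by Pauli labels -/

section Code

variable {n m : ℕ}

/-- The bits of `x` continued by zeros, except that an input of length one is followed by its
complement. -/
def inputBit (x : Bits n) (t : ℕ) : Bool :=
  if h : t < n then x ⟨t, h⟩ else if h : t = 1 ∧ 0 < n then !x ⟨0, h.2⟩ else false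

/-- The block of a qubit. -/
def qubitBlock (q : Fin m) : Fin 4 := ⟨q % 4, Nat.mod_lt _ (by norm_num)⟩

/-- The sum of three labels. -/
def labelSum (a b c : PauliLabel) : PauliLabel := (xor (xor a.1 b.1) c.1, xor (xor a.2 b.2) c.2)

theorem labelSum_left_inj : ∀ {a a' b c}, labelSum a b c = labelSum a' b c → a = a' := by decide

theorem labelSum_middle_inj : ∀ {a b b' c}, labelSum a b c = labelSum a b' c → b = b' := by decide

theorem labelSum_right_inj : ∀ {a b c c'}, labelSum a b c = labelSum a b c' → c = c' := by decide

/-- Six bits of the input label one qubit in each of the first three blocks, and the sum of these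
labels is used in the last block. -/
def codeLabel (x : Bits n) (q : Fin m) : PauliLabel :=
  let b := fun r => inputBit x (6 * (q / 4) + r)
  if q.1 % 4 = 0 then (b 0, b 1) else if q.1 % 4 = 1 then (b 2, b 3)
  else if q.1 % 4 = 2 then (b 4, b 5)
  else labelSum (b 0, b 1) (b 2, b 3) (b 4, b 5)

/-- The codewords of different inputs differ in at least two blocks. -/
theorem exists_codeLabel_ne (hm : 4 * ((n + 5) / 6) ≤ m) {x y : Bits n} (hxy : x ≠ y) :
    ∃ q q' : Fin m, qubitBlock q ≠ qubitBlock q' ∧ codeLabel x q ≠ codeLabel y q ∧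
      codeLabel x q' ≠ codeLabel y q' := by
  obtain ⟨t, ht⟩ := Function.ne_iff.1 hxy
  have htn := t.2
  set p := t.1 / 6 with hp
  have hpm : ∀ i < 4, 4 * p + i < m := fun i hi => by omega
  have hr : inputBit x (6 * p + t.1 % 6) ≠ inputBit y (6 * p + t.1 % 6) := by
    have h : 6 * p + t.1 % 6 = t.1 := by omega
    rw [h]
    simpa [inputBit] using ht
  have hr6 : t.1 % 6 < 6 := Nat.mod_lt _ (by norm_num)
  generalize t.1 % 6 = r at hr hr6
  let q : Fin 4 → Fin m := fun i => ⟨4 * p + i.1, hpm i.1 i.2⟩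
  have hb : ∀ i, qubitBlock (q i) = i := fun i => by
    apply Fin.ext
    have := i.2
    change (4 * p + i.1) % 4 = i.1
    omega
  have hd : ∀ i : Fin 4, (q i).1 / 4 = p ∧ (q i).1 % 4 = i.1 := fun i => by
    have := i.2
    change (4 * p + i.1) / 4 = p ∧ (4 * p + i.1) % 4 = i.1
    omega
  have h0 : ∀ z : Bits n, codeLabel z (q 0) = (inputBit z (6 * p + 0), inputBit z (6 * p + 1)) :=
    fun z => by simp only [codeLabel, hd]; rfl
  have h1 : ∀ z : Bits n, codeLabel z (q 1) = (inputBit z (6 * p + 2), inputBit z (6 * p + 3)) :=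
    fun z => by simp only [codeLabel, hd]; rfl
  have h2 : ∀ z : Bits n, codeLabel z (q 2) = (inputBit z (6 * p + 4), inputBit z (6 * p + 5)) :=
    fun z => by simp only [codeLabel, hd]; rfl
  have h3 : ∀ z : Bits n, codeLabel z (q 3) =
      labelSum (codeLabel z (q 0)) (codeLabel z (q 1)) (codeLabel z (q 2)) :=
    fun z => by rw [h0, h1, h2]; simp only [codeLabel, hd]; rfl
  suffices h : ∃ i j : Fin 4, i ≠ j ∧ codeLabel x (q i) ≠ codeLabel y (q i) ∧
      codeLabel x (q j) ≠ codeLabel y (q j) by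
    obtain ⟨i, j, hij, h1, h2⟩ := h
    exact ⟨q i, q j, by rwa [hb, hb], h1, h2⟩
  -- The differing bit changes one of the first three labels of its group. If it changes only one,
  -- the sum in the fourth block changes too.
  by_cases e0 : codeLabel x (q 0) = codeLabel y (q 0)
  · by_cases e1 : codeLabel x (q 1) = codeLabel y (q 1)
    · by_cases e2 : codeLabel x (q 2) = codeLabel y (q 2)
      · exfalso
        rw [h0, h0, Prod.mk.injEq] at e0
        rw [h1, h1, Prod.mk.injEq] at e1
        rw [h2, h2, Prod.mk.injEq] at e2
        interval_cases r <;> tauto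
      · exact ⟨2, 3, by decide, e2, fun h => e2 (by
          rw [h3, h3, e0, e1] at h; exact labelSum_right_inj h)⟩
    · by_cases e2 : codeLabel x (q 2) = codeLabel y (q 2)
      · exact ⟨1, 3, by decide, e1, fun h => e1 (by
          rw [h3, h3, e0, e2] at h; exact labelSum_middle_inj h)⟩
      · exact ⟨1, 2, by decide, e1, e2⟩
  · by_cases e1 : codeLabel x (q 1) = codeLabel y (q 1)
    · by_cases e2 : codeLabel x (q 2) = codeLabel y (q 2)
      · exact ⟨0, 3, by decide, e0, fun h => e0 (by
          rw [h3, h3, e1, e2] at h; exact labelSum_left_inj h)⟩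
      · exact ⟨0, 2, by decide, e0, e2⟩
    · exact ⟨0, 1, by decide, e0, e1⟩

/-! ### Inputs that realise all Pauli strings on qubits of the first block -/

/-- The input whose codeword has prescribed labels in the first block. -/
def blockInput (n : ℕ) (v : Fin m → PauliLabel) : Bits n := fun t =>
  let w : PauliLabel := if h : 4 * (t.1 / 6) < m then v ⟨4 * (t.1 / 6), h⟩ else PauliLabel.id
  if t.1 % 6 = 0 then w.1 else if t.1 % 6 = 1 then w.2 else false

/-- The qubits of the first block whose labels range over all Pauli labels. -/
def fullQubits (n m : ℕ) : Finset (Fin m) :=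
  Finset.univ.filter fun q => q.1 % 4 = 0 ∧ q.1 / 4 < (n + 4) / 6

theorem card_fullQubits (hm : 4 * ((n + 5) / 6) ≤ m) : (fullQubits n m).card = (n + 4) / 6 := by
  have h : fullQubits n m = Finset.univ.image fun p : Fin ((n + 4) / 6) =>
      (⟨4 * p.1, by have := p.2; omega⟩ : Fin m) := by
    ext q
    simp only [fullQubits, Finset.mem_filter, Finset.mem_univ, true_and, Finset.mem_image]
    constructor
    · rintro ⟨h1, h2⟩
      exact ⟨⟨q.1 / 4, h2⟩, Fin.ext (by simp only; omega)⟩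
    · rintro ⟨p, rfl⟩
      have := p.2
      simp only
      omega
  rw [h, Finset.card_image_of_injective, Finset.card_univ, Fintype.card_fin]
  intro p p' hpp
  have := congrArg Fin.val hpp
  simp only at this
  exact Fin.ext (by omega)

/-- The mask that selects the first block. -/
def firstBlock : Bits 4 := fun i => decide (i = 0)

theorem maskLabel_firstBlock (w : Fin m → PauliLabel) (q : Fin m) :
    maskLabel qubitBlock w firstBlock q = if q.1 % 4 = 0 then w q else PauliLabel.id := by
  simp [maskLabel, firstBlock, qubitBlock, Fin.ext_iff]

/-- This makes every Pauli string on the full qubits one of the strings measured on the first block.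
The hypothesis `2 ≤ n` excludes the complemented bit in `inputBit`. -/
theorem maskLabel_codeLabel_blockInput (hn : 2 ≤ n) {v : Fin m → PauliLabel}
    (hv : v ∈ labelsOn (fullQubits n m)) :
    maskLabel qubitBlock (codeLabel (blockInput n v)) firstBlock = v := by
  rw [mem_labelsOn] at hv
  funext q
  rw [maskLabel_firstBlock]
  split_ifs with hq
  · have hq4 : 4 * (q.1 / 4) = q.1 := by omega
    have hw : ∀ r < 6, ∀ h : 6 * (q.1 / 4) + r < n, blockInput n v ⟨6 * (q.1 / 4) + r, h⟩ =
        if r = 0 then (v q).1 else if r = 1 then (v q).2 else false := by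
      intro r hr h
      have h1 : (6 * (q.1 / 4) + r) / 6 = q.1 / 4 := by omega
      have h2 : (6 * (q.1 / 4) + r) % 6 = r := by omega
      simp only [blockInput, h1, h2, hq4, q.2, dif_pos]
    -- A qubit of the first block is full exactly if both bits of its label lie within the input,
    -- which is the condition `q / 4 < (n + 4) / 6`.
    have hid : ¬ 6 * (q.1 / 4) + 1 < n → v q = PauliLabel.id := fun h => hv q (by
      simp only [fullQubits, Finset.mem_filter, Finset.mem_univ, true_and]; omega)
    have h0 : inputBit (blockInput n v) (6 * (q.1 / 4) + 0) = (v q).1 := by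
      unfold inputBit
      split_ifs with h1 h2
      · rw [hw 0 (by norm_num) h1, if_pos rfl]
      · omega
      · rw [hid (by omega)]
    have h1 : inputBit (blockInput n v) (6 * (q.1 / 4) + 1) = (v q).2 := by
      unfold inputBit
      split_ifs with h1 h2
      · rw [hw 1 (by norm_num) h1, if_neg one_ne_zero, if_pos rfl]
      · omega
      · rw [hid h1]
    simp only [codeLabel, hq, if_true, h0, h1]
  · exact (hv q (by simp [fullQubits, hq])).symm

end Code

end EntanglementReduction

namespace EntanglementReduction

open Matrix

/-! ### Truncated Schmidt decompositions -/

section Truncation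

variable {ι κ : Type} [Fintype ι] [Fintype κ] {φ : EuclideanSpace ℂ (ι × κ)}

/-- The part of a Schmidt decomposition with indices in `T`, as a matrix of coefficients. -/
noncomputable def SchmidtDecomposition.part (D : SchmidtDecomposition φ) (T : Finset (Fin D.rank)) :
    Matrix ι κ ℂ :=
  ∑ l ∈ T, ((√(D.coeff l) : ℝ) : ℂ) • Matrix.vecMulVec (D.left l).ofLp (D.right l).ofLp

theorem SchmidtDecomposition.part_add_compl (D : SchmidtDecomposition φ)
    (T : Finset (Fin D.rank)) : D.part T + D.part Tᶜ = coeffMatrix φ := by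
  classical
  unfold part
  rw [Finset.sum_add_sum_compl]
  ext i j
  rw [Matrix.sum_apply, coeffMatrix, Matrix.of_apply, D.eq_sum]
  rfl

theorem trace_vecMulVec_form (a a' : ι → ℂ) (b b' : κ → ℂ) (P : Matrix ι ι ℂ) (Q : Matrix κ κ ℂ) :
    ((Matrix.vecMulVec a b)ᴴ * (P * Matrix.vecMulVec a' b' * Q)).trace =
      (star a ⬝ᵥ (P *ᵥ a')) * (b' ⬝ᵥ (Q *ᵥ star b)) := by
  rw [Matrix.mul_vecMulVec, Matrix.vecMulVec_mul, Matrix.conjTranspose_vecMulVec,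
    Matrix.vecMulVec_mul_vecMulVec, Matrix.trace_vecMulVec, Matrix.dotProduct_mulVec b',
    dotProduct_comm (b' ᵥ* Q)]
  simp

/-- Each term is a product of a matrix element of `P` and one of `Q`; for Pauli strings, Bessel's
inequality applies to each factor. -/
theorem SchmidtDecomposition.trace_part (D : SchmidtDecomposition φ)
    (T : Finset (Fin D.rank)) (P : Matrix ι ι ℂ) (Q : Matrix κ κ ℂ) :
    ((D.part T)ᴴ * (P * D.part T * Q)).trace =
      ∑ l ∈ T, ∑ l' ∈ T, ((√(D.coeff l) : ℝ) : ℂ) * ((√(D.coeff l') : ℝ) : ℂ) *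
        ((star (D.left l).ofLp ⬝ᵥ (P *ᵥ (D.left l').ofLp)) *
          ((D.right l').ofLp ⬝ᵥ (Q *ᵥ star (D.right l).ofLp))) := by
  unfold part
  rw [conjTranspose_sum, Matrix.sum_mul, Matrix.trace_sum]
  refine Finset.sum_congr rfl fun l _ => ?_
  rw [Matrix.mul_sum, Matrix.sum_mul, Matrix.mul_sum, Matrix.trace_sum]
  refine Finset.sum_congr rfl fun l' _ => ?_
  rw [conjTranspose_smul, Matrix.smul_mul, Matrix.mul_smul, Matrix.smul_mul, Matrix.mul_smul,
    Matrix.trace_smul, Matrix.trace_smul, trace_vecMulVec_form]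
  simp only [smul_eq_mul, Complex.star_def, Complex.conj_ofReal]
  ring

theorem star_dotProduct_of_orthonormal {K : Type} [DecidableEq K] {v : K → EuclideanSpace ℂ ι}
    (hv : Orthonormal ℂ v) (l l' : K) :
    star (v l).ofLp ⬝ᵥ (v l').ofLp = if l = l' then 1 else 0 := by
  rw [← (orthonormal_iff_ite.1 hv) l l', PiLp.inner_apply, dotProduct]
  refine Finset.sum_congr rfl fun i _ => ?_
  simp [mul_comm]

theorem SchmidtDecomposition.frobeniusSq_part (D : SchmidtDecomposition φ)
    (T : Finset (Fin D.rank)) : frobeniusSq (D.part T) = ∑ l ∈ T, D.coeff l := by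
  classical
  rw [← Complex.ofReal_inj, coe_frobeniusSq]
  have h := D.trace_part T 1 1
  rw [Matrix.one_mul, Matrix.mul_one] at h
  rw [h, Complex.ofReal_sum]
  refine Finset.sum_congr rfl fun l hl => ?_
  rw [Finset.sum_eq_single_of_mem l hl]
  · rw [Matrix.one_mulVec, Matrix.one_mulVec, dotProduct_comm (D.right l).ofLp,
      star_dotProduct_of_orthonormal D.left_orthonormal,
      star_dotProduct_of_orthonormal D.right_orthonormal, if_pos rfl, mul_one, mul_one,
      ← Complex.ofReal_mul, Real.mul_self_sqrt (D.coeff_nonneg l)]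
  · intro l' _ hne
    rw [Matrix.one_mulVec, star_dotProduct_of_orthonormal D.left_orthonormal, if_neg hne.symm]
    simp

theorem SchmidtDecomposition.sum_coeff (D : SchmidtDecomposition φ) (hφ : ‖φ‖ = 1) :
    ∑ l, D.coeff l = 1 := by
  classical
  have h := D.part_add_compl Finset.univ
  rw [Finset.compl_univ] at h
  have h2 : D.part ∅ = 0 := by simp [part]
  rw [h2, add_zero] at h
  rw [← D.frobeniusSq_part, h, ← norm_sq_eq_frobeniusSq, hφ, one_pow]

/-- Few Schmidt coefficients carry almost all of the weight of a state of low entanglement. -/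
theorem SchmidtDecomposition.exists_truncation (D : SchmidtDecomposition φ) (hφ : ‖φ‖ = 1)
    (s : ℕ) : ∃ T : Finset (Fin D.rank), (T.card < 2 ^ s) ∧
      s * ∑ l ∈ Tᶜ, D.coeff l ≤ D.entropy := by
  classical
  have h1 : ∀ l, D.coeff l ≤ 1 := fun l => by
    rw [← D.sum_coeff hφ]
    exact Finset.single_le_sum (fun i _ => D.coeff_nonneg i) (Finset.mem_univ l)
  -- Coefficients above `2 ^ (-s)` number fewer than `2 ^ s`, as they sum to at most 1. Each of the
  -- others has `-log₂ λ ≥ s`, so Markov's inequality bounds their weight by the entropy.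
  set T := Finset.univ.filter fun l => ((2 : ℝ) ^ s)⁻¹ < D.coeff l with hT
  refine ⟨T, ?_, ?_⟩
  · have h : ∑ l ∈ T, D.coeff l ≤ 1 := by
      rw [← D.sum_coeff hφ]
      exact Finset.sum_le_sum_of_subset_of_nonneg (Finset.subset_univ _)
        fun i _ _ => D.coeff_nonneg i
    rcases T.eq_empty_or_nonempty with h0 | h0
    · rw [h0]; simp
    · have h2 : ∑ _l ∈ T, ((2 : ℝ) ^ s)⁻¹ < ∑ l ∈ T, D.coeff l :=
        Finset.sum_lt_sum_of_nonempty h0 fun l hl => (Finset.mem_filter.1 hl).2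
      rw [Finset.sum_const, nsmul_eq_mul] at h2
      have h3 := h2.trans_le h
      rw [← div_eq_mul_inv, div_lt_one (by positivity)] at h3
      exact_mod_cast h3
  · have h0 : ∀ l, 0 ≤ -(D.coeff l * Real.logb 2 (D.coeff l)) := fun l => by
      have := Real.logb_nonpos (b := 2) one_lt_two (D.coeff_nonneg l) (h1 l)
      nlinarith [D.coeff_nonneg l]
    have h2 : ∀ l ∈ Tᶜ, s * D.coeff l ≤ -(D.coeff l * Real.logb 2 (D.coeff l)) := by
      intro l hl
      have hl' : D.coeff l ≤ ((2 : ℝ) ^ s)⁻¹ := by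
        simpa [hT] using hl
      rcases (D.coeff_nonneg l).eq_or_lt with h | h
      · simp [← h]
      · have h3 : Real.logb 2 (D.coeff l) ≤ -s := by
          have := Real.logb_le_logb_of_le (b := 2) one_lt_two h hl'
          rwa [Real.logb_inv, Real.logb_pow, Real.logb_self_eq_one one_lt_two, mul_one] at this
        nlinarith
    rw [Finset.mul_sum, entropy, ← Finset.sum_neg_distrib]
    exact (Finset.sum_le_sum h2).trans (Finset.sum_le_sum_of_subset_of_nonneg
      (Finset.subset_univ _) fun l _ _ => h0 l)

end Truncation

/-! ### Correlations of Pauli strings in states of low Schmidt rank -/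

section Correlations

variable {ι : Type} [Fintype ι] [DecidableEq ι]
  {φ : EuclideanSpace ℂ ((ι → Bool) × (ι → Bool))}

/-- The expectation of `P ⊗ Pᵀ`, where `P` is a Pauli string, in the vector with the matrix `M` of
coefficients. -/
noncomputable def pauliCorrelation (M : Matrix (ι → Bool) (ι → Bool) ℂ) (w : ι → PauliLabel) : ℂ :=
  (Mᴴ * (pauliString w * M * pauliString w)).trace

theorem sum_norm_pauliString_dotProduct_sq_le (B : Finset ι) (f g : (ι → Bool) → ℂ) :
    ∑ w ∈ labelsOn B, ‖f ⬝ᵥ (pauliString w *ᵥ g)‖ ^ 2 ≤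
      2 ^ B.card * (∑ a, ‖f a‖ ^ 2) * ∑ b, ‖g b‖ ^ 2 := by
  refine le_trans (le_of_eq ?_) (sum_norm_pauliString_sq_le B f g)
  refine Finset.sum_congr rfl fun w _ => ?_
  simp only [dotProduct, Matrix.mulVec, Finset.mul_sum, mul_assoc]

theorem sum_norm_mul_norm_le (B : Finset ι) {f g f' g' : (ι → Bool) → ℂ}
    (hf : ∑ a, ‖f a‖ ^ 2 = 1) (hg : ∑ a, ‖g a‖ ^ 2 = 1) (hf' : ∑ a, ‖f' a‖ ^ 2 = 1)
    (hg' : ∑ a, ‖g' a‖ ^ 2 = 1) :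
    ∑ w ∈ labelsOn B, ‖f ⬝ᵥ (pauliString w *ᵥ g)‖ * ‖f' ⬝ᵥ (pauliString w *ᵥ g')‖ ≤
      2 ^ B.card := by
  have h1 := sum_norm_pauliString_dotProduct_sq_le B f g
  have h2 := sum_norm_pauliString_dotProduct_sq_le B f' g'
  rw [hf, hg, mul_one, mul_one] at h1
  rw [hf', hg', mul_one, mul_one] at h2
  have h3 : ∑ w ∈ labelsOn B, ‖f ⬝ᵥ (pauliString w *ᵥ g)‖ * ‖f' ⬝ᵥ (pauliString w *ᵥ g')‖ ≤
      ∑ w ∈ labelsOn B, (‖f ⬝ᵥ (pauliString w *ᵥ g)‖ ^ 2 / 2 +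
        ‖f' ⬝ᵥ (pauliString w *ᵥ g')‖ ^ 2 / 2) :=
    Finset.sum_le_sum fun w _ => by
      nlinarith [sq_nonneg (‖f ⬝ᵥ (pauliString w *ᵥ g)‖ - ‖f' ⬝ᵥ (pauliString w *ᵥ g')‖)]
  rw [Finset.sum_add_distrib, ← Finset.sum_div, ← Finset.sum_div] at h3
  linarith

/-- The correlations of the Pauli strings in a vector of low Schmidt rank are small on average. -/
theorem SchmidtDecomposition.sum_norm_pauliCorrelation_le (D : SchmidtDecomposition φ)
    (T : Finset (Fin D.rank)) (B : Finset ι) :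
    ∑ w ∈ labelsOn B, ‖pauliCorrelation (D.part T) w‖ ≤
      2 ^ B.card * (T.card * frobeniusSq (D.part T)) := by
  have hL : ∀ l, ∑ a, ‖(D.left l).ofLp a‖ ^ 2 = 1 := fun l => by
    have := EuclideanSpace.norm_sq_eq (D.left l)
    rw [D.left_orthonormal.1 l, one_pow] at this
    exact this.symm
  have hR : ∀ l, ∑ a, ‖(D.right l).ofLp a‖ ^ 2 = 1 := fun l => by
    have := EuclideanSpace.norm_sq_eq (D.right l)
    rw [D.right_orthonormal.1 l, one_pow] at this
    exact this.symm
  have hs : ∀ f : (ι → Bool) → ℂ, ∑ a, ‖(star f) a‖ ^ 2 = ∑ a, ‖f a‖ ^ 2 := fun f => by simp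
  have h1 : ∀ w, ‖pauliCorrelation (D.part T) w‖ ≤ ∑ l ∈ T, ∑ l' ∈ T,
      √(D.coeff l) * √(D.coeff l') *
        (‖star (D.left l).ofLp ⬝ᵥ (pauliString w *ᵥ (D.left l').ofLp)‖ *
          ‖(D.right l').ofLp ⬝ᵥ (pauliString w *ᵥ star (D.right l).ofLp)‖) := by
    intro w
    rw [pauliCorrelation, D.trace_part]
    refine (norm_sum_le _ _).trans (Finset.sum_le_sum fun l _ => ?_)
    refine (norm_sum_le _ _).trans (Finset.sum_le_sum fun l' _ => le_of_eq ?_)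
    rw [norm_mul, norm_mul, norm_mul, Complex.norm_real, Complex.norm_real,
      Real.norm_of_nonneg (Real.sqrt_nonneg _), Real.norm_of_nonneg (Real.sqrt_nonneg _)]
  refine (Finset.sum_le_sum fun w _ => h1 w).trans ?_
  rw [Finset.sum_comm]
  have h2 : ∀ l ∈ T, ∑ w ∈ labelsOn B, ∑ l' ∈ T, √(D.coeff l) * √(D.coeff l') *
        (‖star (D.left l).ofLp ⬝ᵥ (pauliString w *ᵥ (D.left l').ofLp)‖ *
          ‖(D.right l').ofLp ⬝ᵥ (pauliString w *ᵥ star (D.right l).ofLp)‖) ≤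
      ∑ l' ∈ T, √(D.coeff l) * √(D.coeff l') * 2 ^ B.card := by
    intro l _
    rw [Finset.sum_comm]
    refine Finset.sum_le_sum fun l' _ => ?_
    rw [← Finset.mul_sum]
    refine mul_le_mul_of_nonneg_left ?_ (by positivity)
    exact sum_norm_mul_norm_le B (by rw [hs, hL]) (hL l') (hR l') (by rw [hs, hR])
  refine (Finset.sum_le_sum h2).trans ?_
  simp_rw [← Finset.sum_mul, ← Finset.mul_sum]
  rw [← Finset.sum_mul, mul_comm, D.frobeniusSq_part]
  refine mul_le_mul_of_nonneg_left ?_ (by positivity)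
  -- The double sum of `√λ √λ'` is the square of a sum; Cauchy–Schwarz produces the Schmidt rank
  -- `|T|`.
  have h3 := sq_sum_le_card_mul_sum_sq (s := T) (f := fun l => √(D.coeff l))
  simp_rw [Real.sq_sqrt (D.coeff_nonneg _)] at h3
  rwa [sq] at h3

omit [DecidableEq ι] in
theorem pauliString_conj_eq (w : ι → PauliLabel) : (pauliString w)ᴴ = pauliString w :=
  isHermitian_pauliString w

theorem norm_trace_pauliString_le (M N : Matrix (ι → Bool) (ι → Bool) ℂ) (w : ι → PauliLabel) :
    ‖(Mᴴ * (pauliString w * N * pauliString w)).trace‖ ≤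
      √(frobeniusSq M) * √(frobeniusSq N) := by
  refine (norm_trace_mul_le _ _).trans (le_of_eq ?_)
  rw [frobeniusSq_mul_unitary, frobeniusSq_unitary_mul] <;>
    rw [pauliString_conj_eq, pauliString_mul_self]

/-- Correlations change little if a vector of small norm is added. -/
theorem re_pauliCorrelation_add_le (M N : Matrix (ι → Bool) (ι → Bool) ℂ) (w : ι → PauliLabel) :
    (pauliCorrelation (M + N) w).re ≤ ‖pauliCorrelation M w‖ +
      2 * (√(frobeniusSq M) * √(frobeniusSq N)) + frobeniusSq N := by
  have h : pauliCorrelation (M + N) w = pauliCorrelation M w +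
      (Mᴴ * (pauliString w * N * pauliString w)).trace +
      (Nᴴ * (pauliString w * M * pauliString w)).trace +
      (Nᴴ * (pauliString w * N * pauliString w)).trace := by
    unfold pauliCorrelation
    simp only [conjTranspose_add, Matrix.mul_add, Matrix.add_mul, Matrix.trace_add]
    ring
  have h1 := (Complex.re_le_norm _).trans (norm_trace_pauliString_le M N w)
  have h2 := (Complex.re_le_norm _).trans (norm_trace_pauliString_le N M w)
  have h3 := (Complex.re_le_norm _).trans (norm_trace_pauliString_le N N w)
  have h4 := Complex.re_le_norm (pauliCorrelation M w)
  rw [Real.mul_self_sqrt (frobeniusSq_nonneg N)] at h3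
  rw [h, Complex.add_re, Complex.add_re, Complex.add_re]
  linarith

end Correlations

end EntanglementReduction

namespace EntanglementReduction

open Matrix

/-! ### The protocol for Equality -/

section Equality

variable {n m : ℕ}

/-- On input `x`, both parties measure four commuting Pauli strings, one on each block, whose
labels are given by the codeword of `x`. -/
noncomputable def pauliOperations (n m : ℕ) : OneRoundOperations n m 0 1 4 Bool :=
  compareOperations (fun x => spectralProj fun s =>
      pauliString (maskLabel (qubitBlock (m := m)) (codeLabel x) s))
    fun x => (isReflectionGroup_maskLabel qubitBlock (codeLabel x)).isProjectiveMeasurement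

/-- The protocol for Equality that starts with `m` EPR pairs. -/
noncomputable def equalityProtocol (n m : ℕ) : OneRoundProtocol n m 0 1 4 Bool where
  ops := pauliOperations n m
  prior := eprPairs m
  norm_prior := norm_eprPairs m

theorem ops_equalityProtocol (n m : ℕ) : (equalityProtocol n m).ops =
    compareOperations (fun x => spectralProj fun s =>
      pauliString (maskLabel (qubitBlock (m := m)) (codeLabel x) s))
    fun x => (isReflectionGroup_maskLabel qubitBlock (codeLabel x)).isProjectiveMeasurement := rfl

theorem outputProb_equalityProtocol_self (x : Bits n) :
    (equalityProtocol n m).outputProb x x true = 1 := by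
  have h := outputProb_true_add_false (ops_equalityProtocol n m) x x
  rwa [outputProb_false_eprPairs_self (ops_equalityProtocol n m) rfl, add_zero] at h

theorem outputProb_equalityProtocol_ne (hm : 4 * ((n + 5) / 6) ≤ m) {x y : Bits n} (hxy : x ≠ y) :
    (equalityProtocol n m).outputProb x y true ≤ 1 / 4 := by
  obtain ⟨q, q', hq, hx, hy⟩ := exists_codeLabel_ne hm hxy
  have h := card_maskLabel_eq_le hq hx hy
  rw [outputProb_true_eprPairs (ops_equalityProtocol n m) rfl, sum_trace_spectralProj_mul]
  have h2 : ∀ s, (pauliString (maskLabel qubitBlock (codeLabel x) s) *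
      pauliString (maskLabel (qubitBlock (m := m)) (codeLabel y) s)).trace =
      (((if maskLabel qubitBlock (codeLabel x) s =
        maskLabel (qubitBlock (m := m)) (codeLabel y) s then (1 : ℝ) else 0) * 2 ^ m : ℝ) : ℂ) := by
    intro s
    rw [trace_pauliString_mul, Fintype.card_fin]
    split_ifs <;> simp
  simp_rw [h2]
  rw [← Complex.ofReal_sum, ← Finset.sum_mul,
    show ((2 : ℂ) ^ 4)⁻¹ = ((((2 : ℝ) ^ 4)⁻¹ : ℝ) : ℂ) by norm_num, ← Complex.ofReal_mul,
    Complex.ofReal_re]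
  have h3 : (0 : ℝ) < 2 ^ m := by positivity
  generalize (∑ s, if maskLabel qubitBlock (codeLabel x) s =
    maskLabel (qubitBlock (m := m)) (codeLabel y) s then (1 : ℝ) else 0) = S at h
  have h4 : ((2 : ℝ) ^ m)⁻¹ * (((2 : ℝ) ^ 4)⁻¹ * (S * 2 ^ m)) = S / 16 := by
    field_simp
    ring
  rw [h4]
  linarith

theorem computes_equalityProtocol (hm : 4 * ((n + 5) / 6) ≤ m) :
    (equalityProtocol n m).Computes (1 / 3) (equality n) := by
  intro x y
  by_cases h : x = y
  · subst h
    rw [equality, decide_eq_true rfl, outputProb_equalityProtocol_self]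
    norm_num
  · rw [equality, decide_eq_false h]
    have h1 := outputProb_true_add_false (ops_equalityProtocol n m) x y
    have h2 := outputProb_equalityProtocol_ne hm h
    linarith

/-- In a similar protocol, the Pauli strings measured on the first block are strongly correlated. -/
theorem lt_re_pauliCorrelation {P : OneRoundProtocol n m 0 1 4 Bool}
    (hP : Similar (equalityProtocol n m) P) (x : Bits n) :
    9 / 10 < (pauliCorrelation (coeffMatrix P.prior)
      (maskLabel qubitBlock (codeLabel x) firstBlock)).re := by
  obtain ⟨hops, hTV⟩ := hP
  have hops' : P.ops = pauliOperations n m := hops.symm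
  have h1 := hTV x x
  rw [totalVariation, Fintype.sum_bool, outputProb_equalityProtocol_self,
    outputProb_false_eprPairs_self (ops_equalityProtocol n m) rfl] at h1
  have h2 := outputProb_true_add_false hops' x x
  have h3 : 19 / 20 < P.outputProb x x true := by
    have ha := le_abs_self (1 - P.outputProb x x true)
    have hb := neg_le_abs (0 - P.outputProb x x false)
    linarith
  rw [outputProb_compareOperations hops'] at h3
  -- Acceptance is at most `(1 + correlation) / 2`, so acceptance above 19/20 forces a correlation
  -- above 9/10.
  have h4 := (isReflectionGroup_maskLabel (qubitBlock (m := m)) (codeLabel x)).sum_frobeniusSq_le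
    firstBlock (coeffMatrix P.prior)
  rw [← norm_sq_eq_frobeniusSq, P.norm_prior] at h4
  have h5 := h3.trans_le h4
  unfold pauliCorrelation
  linarith

/-- All `4 ^ k` strings on the full qubits would have correlation above 11/20, whereas their average
is at most `|T| / 2 ^ k ≤ 1/2`. -/
theorem fullQubits_correlation_contradiction (hn : 2 ≤ n) (hm : 4 * ((n + 5) / 6) ≤ m)
    {φ : EuclideanSpace ℂ (Bits m × Bits m)} (D : SchmidtDecomposition φ)
    (T : Finset (Fin D.rank)) (hT : T.card < 2 ^ ((n + 14) / 15))
    (h1 : frobeniusSq (D.part T) ≤ 1)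
    (h : ∀ x : Bits n, 11 / 20 < ‖pauliCorrelation (D.part T)
      (maskLabel qubitBlock (codeLabel x) firstBlock)‖) : False := by
  have hsum := D.sum_norm_pauliCorrelation_le T (fullQubits n m)
  have hcard := card_fullQubits hm
  rw [hcard] at hsum
  set k := (n + 4) / 6 with hk
  -- The exponent `⌈n / 15⌉` is at most `k - 1` unless it equals 1; in that case `|T| ≤ 1` is
  -- enough.
  have hT' : (T.card : ℝ) ≤ 2 ^ (k - 1) := by
    have : T.card ≤ 2 ^ (k - 1) := by
      by_cases hs : (n + 14) / 15 = 1
      · rw [hs] at hT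
        have := Nat.one_le_two_pow (n := k - 1)
        omega
      · exact hT.le.trans (Nat.pow_le_pow_right (by norm_num) (by omega))
    exact_mod_cast this
  have hlow : ∑ _w ∈ labelsOn (fullQubits n m), (11 / 20 : ℝ) ≤
      ∑ w ∈ labelsOn (fullQubits n m), ‖pauliCorrelation (D.part T) w‖ := by
    refine Finset.sum_le_sum fun w hw => ?_
    have := h (blockInput n w)
    rw [maskLabel_codeLabel_blockInput hn hw] at this
    exact this.le
  rw [Finset.sum_const, card_labelsOn, hcard, nsmul_eq_mul] at hlow
  have h4 : T.card * frobeniusSq (D.part T) ≤ 2 ^ (k - 1) := by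
    have := frobeniusSq_nonneg (D.part T)
    nlinarith
  have h5 : ((4 ^ k : ℕ) : ℝ) = 2 ^ k * (2 * 2 ^ (k - 1)) := by
    rw [← pow_succ', Nat.sub_add_cancel (by omega), ← mul_pow]
    norm_num
  have h6 : (0 : ℝ) < 2 ^ k * 2 ^ (k - 1) := by positivity
  have h7 : (2 : ℝ) ^ k * (T.card * frobeniusSq (D.part T)) ≤ 2 ^ k * 2 ^ (k - 1) :=
    mul_le_mul_of_nonneg_left h4 (by positivity)
  rw [h5] at hlow
  nlinarith

theorem maskLabel_codeLabel_bit (x : Bits 1) (q : Fin m) :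
    maskLabel qubitBlock (codeLabel x) firstBlock q =
      if q.1 = 0 then (x 0, !x 0) else PauliLabel.id := by
  rw [maskLabel_firstBlock]
  by_cases hq : q.1 = 0
  · simp [hq, codeLabel, inputBit]
  · rw [if_neg hq]
    split_ifs with h4
    · have h0 : ¬ 6 * (q.1 / 4) + 0 < 1 := by omega
      have h1 : ¬ 6 * (q.1 / 4) + 1 < 1 := by omega
      have h2 : ¬ (6 * (q.1 / 4) + 0 = 1 ∧ 0 < 1) := by omega
      have h3 : ¬ (6 * (q.1 / 4) + 1 = 1 ∧ 0 < 1) := by omega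
      simp only [codeLabel, h4, if_true, inputBit, dif_neg h0, dif_neg h1, dif_neg h2, dif_neg h3]
    · rfl

/-- The complemented bit in `inputBit` gives the two inputs the labels of `Z` and `X`. With `|T| ≤
1` and `μ` the squared norm of the truncated vector, the correlations of `1`, `X`, `Y`, `Z` on one
qubit have absolute values summing to at most `2 * μ`. The identity takes `μ` of this, and what
remains, at most 1, is less than `2 * 11/20`. -/
theorem bit_correlation_contradiction (hm : 0 < m)
    {φ : EuclideanSpace ℂ (Bits m × Bits m)} (D : SchmidtDecomposition φ)
    (T : Finset (Fin D.rank)) (hT : T.card < 2) (h1 : frobeniusSq (D.part T) ≤ 1)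
    (h : ∀ x : Bits 1, 11 / 20 < ‖pauliCorrelation (D.part T)
      (maskLabel qubitBlock (codeLabel x) firstBlock)‖) : False := by
  have hsum := D.sum_norm_pauliCorrelation_le T {(⟨0, hm⟩ : Fin m)}
  set w : Bool → Fin m → PauliLabel := fun b =>
    maskLabel qubitBlock (codeLabel (fun _ : Fin 1 => b)) firstBlock with hw
  have hw0 : ∀ b, w b ⟨0, hm⟩ = (b, !b) := fun b => by
    rw [hw]
    simp only
    rw [maskLabel_codeLabel_bit, if_pos rfl]
  have hmem : ∀ b, w b ∈ labelsOn {(⟨0, hm⟩ : Fin m)} := fun b => by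
    rw [mem_labelsOn]
    intro i hi
    rw [hw]
    simp only
    rw [maskLabel_codeLabel_bit, if_neg]
    simpa [Fin.ext_iff] using hi
  have hid : (fun _ => PauliLabel.id) ∈ labelsOn {(⟨0, hm⟩ : Fin m)} :=
    mem_labelsOn.2 fun _ _ => rfl
  have hne : ∀ b, (fun _ => PauliLabel.id) ≠ w b := fun b hb => by
    have := congrFun hb ⟨0, hm⟩
    rw [hw0] at this
    cases b <;> simp [PauliLabel.id] at this
  have hne' : w false ≠ w true := fun hb => by
    have := congrFun hb ⟨0, hm⟩
    rw [hw0, hw0] at this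
    simp at this
  have hsub : ({fun _ => PauliLabel.id, w false, w true} : Finset (Fin m → PauliLabel)) ⊆
      labelsOn {(⟨0, hm⟩ : Fin m)} := by
    intro v hv
    simp only [Finset.mem_insert, Finset.mem_singleton] at hv
    rcases hv with rfl | rfl | rfl
    exacts [hid, hmem _, hmem _]
  have hle := Finset.sum_le_sum_of_subset_of_nonneg
    (f := fun w => ‖pauliCorrelation (D.part T) w‖) hsub fun _ _ _ => norm_nonneg _
  rw [Finset.sum_insert (by simp [hne]), Finset.sum_pair hne'] at hle
  have hpid : ‖pauliCorrelation (D.part T) fun _ => PauliLabel.id‖ = frobeniusSq (D.part T) := by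
    rw [pauliCorrelation, pauliString_id, Matrix.one_mul, Matrix.mul_one, ← coe_frobeniusSq,
      Complex.norm_real, Real.norm_of_nonneg (frobeniusSq_nonneg _)]
  have hf := h fun _ => false
  have ht := h fun _ => true
  have hT' : (T.card : ℝ) ≤ 1 := by exact_mod_cast Nat.lt_succ_iff.1 hT
  rw [hpid] at hle
  rw [Finset.card_singleton, pow_one] at hsum
  have := frobeniusSq_nonneg (D.part T)
  have h5 : T.card * frobeniusSq (D.part T) ≤ frobeniusSq (D.part T) := by nlinarith
  linarith

/-- No protocol that is similar to the protocol for Equality starts with little entanglement. -/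
theorem lt_entanglement_of_similar (hn : 1 ≤ n) (hm : 4 * ((n + 5) / 6) ≤ m)
    {P : OneRoundProtocol n m 0 1 4 Bool} (hP : Similar (equalityProtocol n m) P) :
    (n : ℝ) / 600 < entanglement P.prior := by
  by_contra! hE
  obtain ⟨D⟩ := nonempty_schmidtDecomposition P.prior
  rw [entanglement_eq D] at hE
  -- With `s = ⌈n / 15⌉`, the discarded weight is at most `(n / 600) / s ≤ 15 / 600 = 1 / 40`.
  obtain ⟨T, hT, hδ⟩ := D.exists_truncation P.norm_prior ((n + 14) / 15)
  rw [← D.frobeniusSq_part] at hδ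
  have hμ : frobeniusSq (D.part T) ≤ 1 := by
    rw [D.frobeniusSq_part, ← D.sum_coeff P.norm_prior]
    exact Finset.sum_le_sum_of_subset_of_nonneg (Finset.subset_univ _)
      fun i _ _ => D.coeff_nonneg i
  have hδ0 := frobeniusSq_nonneg (D.part Tᶜ)
  have hδ1 : frobeniusSq (D.part Tᶜ) ≤ 1 / 40 := by
    have h1 : (n : ℝ) ≤ 15 * ((n + 14) / 15 : ℕ) := by
      have : n ≤ 15 * ((n + 14) / 15) := by omega
      exact_mod_cast this
    have h2 : (1 : ℝ) ≤ ((n + 14) / 15 : ℕ) := by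
      have : 1 ≤ (n + 14) / 15 := by omega
      exact_mod_cast this
    have h3 := hδ.trans hE
    by_contra! hcon
    nlinarith
  -- Since `√(1/40) < 16/100`, at least `9/10 - 2 * 16/100 - 1/40 = 0.555` of the correlation
  -- survives.
  have hkey : ∀ x : Bits n, 11 / 20 < ‖pauliCorrelation (D.part T)
      (maskLabel qubitBlock (codeLabel x) firstBlock)‖ := by
    intro x
    have h1 := lt_re_pauliCorrelation hP x
    rw [← D.part_add_compl T] at h1
    have h2 := re_pauliCorrelation_add_le (D.part T) (D.part Tᶜ)
      (maskLabel qubitBlock (codeLabel x) firstBlock)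
    have h3 : √(frobeniusSq (D.part T)) ≤ 1 := Real.sqrt_le_one.2 hμ
    have h4 : √(frobeniusSq (D.part Tᶜ)) ≤ 16 / 100 :=
      Real.sqrt_le_iff.2 ⟨by norm_num, by norm_num; linarith⟩
    have h5 : √(frobeniusSq (D.part T)) * √(frobeniusSq (D.part Tᶜ)) ≤ 1 * (16 / 100) :=
      mul_le_mul h3 h4 (Real.sqrt_nonneg _) zero_le_one
    linarith
  rcases hn.eq_or_lt with h1 | h1
  · subst h1
    exact bit_correlation_contradiction (by omega) D T hT hμ hkey
  · exact fullQubits_correlation_contradiction h1 hm D T hT hμ hkey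

end Equality

end EntanglementReduction

open EntanglementReduction in
theorem mainTheorem10 :
    ∃ c₁ c₂ : ℝ, 0 < c₁ ∧ ∀ n : ℕ, 1 ≤ n →
      ∃ (m a b : ℕ) (P : OneRoundProtocol n m a b 4 Bool),
        2 * (n : ℝ) / 3 + Real.logb 2 n + c₁ ≤ m ∧
        (m : ℝ) ≤ 2 * (n : ℝ) / 3 + Real.logb 2 n + c₂ ∧
        P.prior = eprPairs m ∧
        P.Computes (1 / 3) (equality n) ∧
        ¬ ∃ P' : OneRoundProtocol n m a b 4 Bool,
          Similar P P' ∧ entanglement P'.prior ≤ (n : ℝ) / 600 := by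
  -- The code needs `4 * ⌈n / 6⌉ ≤ 2 * n / 3 + 10 / 3` qubits, so `c₁ = 4` suffices, and rounding up
  -- costs at most 1. The logarithmic term only adds EPR pairs that carry identity labels.
  refine ⟨4, 5, by norm_num, fun n hn => ?_⟩
  have hlog : 0 ≤ Real.logb 2 n := Real.logb_nonneg one_lt_two (by exact_mod_cast hn)
  set r : ℝ := 2 * (n : ℝ) / 3 + Real.logb 2 n + 4 with hr
  have hr0 : 0 ≤ r := by positivity
  have hm : 4 * ((n + 5) / 6) ≤ ⌈r⌉₊ := by
    have h1 : (((4 * ((n + 5) / 6) : ℕ)) : ℝ) ≤ ⌈r⌉₊ := by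
      have h2 : 6 * ((((n + 5) / 6 : ℕ)) : ℝ) ≤ n + 5 := by
        have : 6 * ((n + 5) / 6) ≤ n + 5 := by omega
        exact_mod_cast this
      have h3 := Nat.le_ceil r
      rw [Nat.cast_mul]
      push_cast at h2 ⊢
      linarith
    exact_mod_cast h1
  refine ⟨⌈r⌉₊, 0, 1, equalityProtocol n ⌈r⌉₊, Nat.le_ceil r, ?_, rfl,
    computes_equalityProtocol hm, ?_⟩
  · have := Nat.ceil_lt_add_one hr0
    linarith
  · rintro ⟨P', hP', hE⟩
    exact absurd hE (not_le.2 (lt_entanglement_of_similar hn hm hP'))
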